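/- Let $r\ge 3$ be an integer. For $p_0\in(0,1)$ consider the system of differential equations, for positive functions $\hat w,\hat b,\hat q,\hat s,\hat t$ on $[0,\infty)$, $$\hat w'=-r\hat s,\qquad \hat b'=-\hat b-r\hat t+r\hat s,\qquad \hat q'=-\frac{(2r-2)\hat q\hat s}{\hat w},$$ $$\hat s'=-\hat s+\frac{(r-1)\hat q\hat s}{\hat w}-\frac{(r-1)\hat s^2}{\hat w}-\frac{r(r-2)\hat s\hat t}{(r-1)\hat b},\qquad \hat t'=-2\hat t+\frac{2(r-1)\hat s^2}{\hat w}-\frac{2r(r-2)\hat t^2}{(r-1)\hat b},$$ with $\hat w(0)=(1-p_0)^{r+1}$, $\hat b(0)=rp_0(1-p_0)^r$, $\hat q(0)=(1-p_0)^{2r}$, $\hat s(0)=(r-1)p_0(1-p_0)^{2r-1}$, $\hat t(0)=(r-1)^2p_0^2(1-p_0)^{2r-2}$. Put $$\xi(r,p_0)=p_0(1-p_0)^r+\int_0^\infty\hat b(x)\,dx+\begin{cases}\lim_{x\to\infty}\hat w(x)&\text{if }\lim_{x\to\infty}\frac{(r-1)\hat q(x)}{\hat w(x)}<1,\\0&\text{otherwise,}\end{cases}\qquad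 \xi(r)=\sup_{0<p_0<1}\xi(r,p_0).$$ For a finite simple graph $G$ let $\tau(G)$ be the maximum number of vertices of an induced forest (an acyclic induced subgraph) of $G$; the girth of $G$ is the length of a shortest cycle, and $\infty$ if $G$ is acyclic. Then the following hold. 1. For every $p_0\in(0,1)$ the number $\xi(r,p_0)$ is well defined (a positive solution on $[0,\infty)$ exists, the integral and the limits converge, and the value does not depend on the choice of the solution), and the supremum $\xi(r)$ is finite. 2. For every $\delta>0$ there is an integer $g>0$, depending only on $\delta$ and $r$, such that every graph $G$ on $n$ vertices with maximum degree at most $r$ and girth at least $g$ satisfies $\tau(G)\ge(\xi(r)-\delta)n$. 3. For $r=3,4,\dots,10$ let $c_r$ be, respectively, $0.7268,\ 0.6045,\ 0.5269,\ 0.4711,\ 0.4283,\ 0.3940,\ 0.3658,\ 0.3419$. For each such $r$ there is $p_0\in(0,1)$ with $c_r\le\xi(r,p_0)<c_r+10^{-4}$; in particular $\xi(r)\ge c_r$. -/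

import Mathlib

open Set Filter Topology MeasureTheory

noncomputable section

namespace InducedForest

/-- `τ(G)`: the maximum number of vertices of an induced forest of `G`, i.e. of an acyclic
induced subgraph. -/
def tau {V : Type*} [Fintype V] (G : SimpleGraph V) : ℕ :=
  sSup {k : ℕ | ∃ S : Finset V, (G.induce (S : Set V)).IsAcyclic ∧ S.card = k}

/-- `(w, b, q, s, t)` is a positive solution, on the whole half-line `[0, ∞)`, of the system of
differential equations associated with `(r, p₀)`. -/
structure IsSolution (r : ℕ) (p₀ : ℝ) (w b q s t : ℝ → ℝ) : Prop where
  pos : ∀ x, 0 ≤ x → 0 < w x ∧ 0 < b x ∧ 0 < q x ∧ 0 < s x ∧ 0 < t x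
  deriv_w : ∀ x, 0 ≤ x → HasDerivWithinAt w (-(r : ℝ) * s x) (Ici 0) x
  deriv_b : ∀ x, 0 ≤ x → HasDerivWithinAt b (-b x - r * t x + r * s x) (Ici 0) x
  deriv_q : ∀ x, 0 ≤ x →
    HasDerivWithinAt q (-((2 * (r : ℝ) - 2) * q x * s x / w x)) (Ici 0) x
  deriv_s : ∀ x, 0 ≤ x →
    HasDerivWithinAt s
      (-s x + ((r : ℝ) - 1) * q x * s x / w x - ((r : ℝ) - 1) * s x ^ 2 / w x
        - (r : ℝ) * ((r : ℝ) - 2) * s x * t x / (((r : ℝ) - 1) * b x)) (Ici 0) x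
  deriv_t : ∀ x, 0 ≤ x →
    HasDerivWithinAt t
      (-2 * t x + 2 * ((r : ℝ) - 1) * s x ^ 2 / w x
        - 2 * (r : ℝ) * ((r : ℝ) - 2) * t x ^ 2 / (((r : ℝ) - 1) * b x)) (Ici 0) x
  init_w : w 0 = (1 - p₀) ^ (r + 1)
  init_b : b 0 = r * p₀ * (1 - p₀) ^ r
  init_q : q 0 = (1 - p₀) ^ (2 * r)
  init_s : s 0 = ((r : ℝ) - 1) * p₀ * (1 - p₀) ^ (2 * r - 1)
  init_t : t 0 = ((r : ℝ) - 1) ^ 2 * p₀ ^ 2 * (1 - p₀) ^ (2 * r - 2)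

/-- `c` is the constant `ξ(r, p₀)`: with the solution of the system associated with `(r, p₀)`,
it is `p₀ (1 - p₀)^r + ∫₀^∞ b + lim w` if `lim (r - 1) q / w < 1`, and
`p₀ (1 - p₀)^r + ∫₀^∞ b` otherwise; convergence of the integral and of the two limits is
part of the definition. -/
def IsXi (r : ℕ) (p₀ c : ℝ) : Prop :=
  ∃ w b q s t : ℝ → ℝ, IsSolution r p₀ w b q s t ∧ IntegrableOn b (Ioi 0) ∧
    ∃ wlim ρ : ℝ, Tendsto w atTop (𝓝 wlim) ∧
      Tendsto (fun x => ((r : ℝ) - 1) * q x / w x) atTop (𝓝 ρ) ∧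
      c = p₀ * (1 - p₀) ^ r + (∫ x in Ioi (0 : ℝ), b x) + (if ρ < 1 then wlim else 0)

/-- The set of all constants `ξ(r, p₀)` with `0 < p₀ < 1`. -/
def xiValues (r : ℕ) : Set ℝ :=
  {c | ∃ p₀ ∈ Ioo (0 : ℝ) 1, IsXi r p₀ c}

/-- `ξ(r)`: the best of the constants `ξ(r, p₀)`, i.e. their supremum over `0 < p₀ < 1`. -/
def xi (r : ℕ) : ℝ := sSup (xiValues r)

/-- The tabulated numerical values, for `3 ≤ r ≤ 10` (the value elsewhere is not used). -/
def tableXi : ℕ → ℝ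
  | 3 => 0.7268
  | 4 => 0.6045
  | 5 => 0.5269
  | 6 => 0.4711
  | 7 => 0.4283
  | 8 => 0.3940
  | 9 => 0.3658
  | 10 => 0.3419
  | _ => 0

end InducedForest

end

/-!
Along a solution, `w`, `b`, `q`, `s` and `t` are explicit in two quantities: the fraction `f` of the
branches at a vertex through which it has not been reached, and the activity, the fraction through
which it is about to be reached. The activity is a function of `f` alone, so that everything
reduces to the scalar equation `df/dx = -(rate * activity)`, along which `f` decreases from `1 - p`
to the zero `φ` of the activity; integrating gives a closed form of `ξ(r, p)` in `φ`, and bracketing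
`φ` gives the table.

For the graphs, vertices are explored in rounds of size `ε`, driven by independent coins. Where
balls are trees, the branches at a vertex are independent, and the probability that a branch has not
arrived obeys exactly the Euler scheme of the scalar equation. Explored vertices with a single
active branch and no neighbour activated in the same round, together with the unexplored vertices
that lie in shallow unexplored components, induce a forest, whose expected density tends to
`ξ(r, p)` as `ε → 0`.
-/

noncomputable section

namespace InducedForest

/-- The rate at which the surviving fraction `f` of branches decreases, per unit of activity. -/
def rate (r : ℕ) (p f : ℝ) : ℝ := (1 - p) * ((r : ℝ) - 1) * f ^ (r - 2)

/-- The active fraction of branches as a function of the surviving fraction `f`, along the solution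
that starts at `f = 1 - p` with activity `p`: the first integral of the system. -/
def activity (r : ℕ) (p f : ℝ) : ℝ := 1 - f - ∫ x in f..(1 - p), (rate r p x)⁻¹

/-- `φ` is the surviving fraction at which the activity dies out. -/
structure IsTerminalFraction (r : ℕ) (p φ : ℝ) : Prop where
  pos : 0 < φ
  lt_init : φ < 1 - p
  activity_eq_zero : activity r p φ = 0

/-- The closed form of `ξ(r, p)` in terms of the terminal fraction `φ`. -/
def xiVal (r : ℕ) (p φ : ℝ) : ℝ :=
  p * (1 - p) ^ r + (r : ℝ) / (2 * ((r : ℝ) - 1)) * ((1 - p) ^ 2 - φ ^ 2) + (1 - p) * φ ^ r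

section Activity

variable {r : ℕ} {p φ f g : ℝ}

lemma one_le_cast_sub_one (hr : 2 ≤ r) : (1 : ℝ) ≤ (r : ℝ) - 1 := by
  have : (2 : ℝ) ≤ r := by exact_mod_cast hr
  linarith

lemma IsTerminalFraction.lt_one (h : IsTerminalFraction r p φ) : p < 1 := by
  linarith [h.pos, h.lt_init]

lemma rate_pos (hr : 2 ≤ r) (hp₁ : p < 1) (hf : 0 < f) : 0 < rate r p f := by
  have := one_le_cast_sub_one hr
  have := sub_pos.2 hp₁
  unfold rate
  positivity

lemma rate_mono (hr : 2 ≤ r) (hp₁ : p < 1) (hf : 0 ≤ f) (hfg : f ≤ g) :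
    rate r p f ≤ rate r p g :=
  mul_le_mul_of_nonneg_left (pow_le_pow_left₀ hf hfg _)
    (mul_nonneg (sub_nonneg.2 hp₁.le) (by linarith [one_le_cast_sub_one hr]))

lemma inv_rate_anti (hr : 2 ≤ r) (hp₁ : p < 1) (hf : 0 < f) (hfg : f ≤ g) :
    (rate r p g)⁻¹ ≤ (rate r p f)⁻¹ :=
  inv_anti₀ (rate_pos hr hp₁ hf) (rate_mono hr hp₁ hf.le hfg)

lemma rate_le_mul (hr : 3 ≤ r) (hp₀ : 0 ≤ p) (hf : 0 ≤ f) (hf₁ : f ≤ 1) :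
    rate r p f ≤ ((r : ℝ) - 1) * f := by
  have hr₁ := one_le_cast_sub_one (r := r) (by omega)
  have hpow : f ^ (r - 2) ≤ f := pow_le_of_le_one hf hf₁ (by omega)
  calc (1 - p) * ((r : ℝ) - 1) * f ^ (r - 2) ≤ 1 * ((r : ℝ) - 1) * f := by
        gcongr; linarith
    _ = ((r : ℝ) - 1) * f := by rw [one_mul]

lemma continuous_rate : Continuous (rate r p) := by
  unfold rate; fun_prop

lemma continuousOn_inv_rate (hr : 2 ≤ r) (hp₁ : p < 1) :
    ContinuousOn (fun x => (rate r p x)⁻¹) (Ioi 0) :=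
  continuous_rate.continuousOn.inv₀ fun _ hx => (rate_pos hr hp₁ hx).ne'

lemma intervalIntegrable_inv_rate (hr : 2 ≤ r) (hp₁ : p < 1) (hf : 0 < f) (hg : 0 < g) :
    IntervalIntegrable (fun x => (rate r p x)⁻¹) volume f g :=
  ((continuousOn_inv_rate hr hp₁).mono fun _ hx => (lt_min hf hg).trans_le hx.1).intervalIntegrable

lemma hasDerivAt_activity (hr : 2 ≤ r) (hp₁ : p < 1) (hf : 0 < f) :
    HasDerivAt (activity r p) (-1 + (rate r p f)⁻¹) f := by
  have hcont := continuousOn_inv_rate (p := p) hr hp₁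
  have hint := intervalIntegral.integral_hasDerivAt_left
    (intervalIntegrable_inv_rate hr hp₁ hf (sub_pos.2 hp₁))
    (hcont.stronglyMeasurableAtFilter isOpen_Ioi f hf)
    (hcont.continuousAt (Ioi_mem_nhds hf))
  exact (((hasDerivAt_id f).const_sub 1).sub hint).congr_deriv (by ring)

lemma activity_one_sub : activity r p (1 - p) = p := by simp [activity]

lemma continuousOn_activity (hr : 2 ≤ r) (hp₁ : p < 1) : ContinuousOn (activity r p) (Ioi 0) :=
  fun _ hx => (hasDerivAt_activity hr hp₁ hx).continuousAt.continuousWithinAt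

lemma concaveOn_activity (hr : 2 ≤ r) (hp₁ : p < 1) :
    ConcaveOn ℝ (Ioi 0) (activity r p) := by
  apply AntitoneOn.concaveOn_of_deriv (convex_Ioi _) (continuousOn_activity hr hp₁) <;>
    rw [interior_Ioi]
  · exact fun x hx => (hasDerivAt_activity hr hp₁ hx).differentiableAt.differentiableWithinAt
  · intro x hx y hy hxy
    rw [(hasDerivAt_activity hr hp₁ hx).deriv, (hasDerivAt_activity hr hp₁ hy).deriv]
    linarith [inv_rate_anti hr hp₁ hx hxy]

lemma activity_sub_le (hr : 2 ≤ r) (hp₁ : p < 1) (hg : 0 < g) (hgf : g ≤ f) :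
    activity r p f - activity r p g ≤ (-1 + (rate r p g)⁻¹) * (f - g) := by
  rcases hgf.eq_or_lt with rfl | hlt
  · simp
  · have := (concaveOn_activity hr hp₁).slope_le_of_hasDerivAt (mem_Ioi.2 hg)
      (mem_Ioi.2 (hg.trans hlt)) hlt (hasDerivAt_activity hr hp₁ hg)
    rwa [slope_def_field, div_le_iff₀ (sub_pos.2 hlt)] at this

lemma le_activity_sub (hr : 2 ≤ r) (hp₁ : p < 1) (hg : 0 < g) (hgf : g ≤ f) :
    (-1 + (rate r p f)⁻¹) * (f - g) ≤ activity r p f - activity r p g := by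
  rcases hgf.eq_or_lt with rfl | hlt
  · simp
  · have hf := hg.trans hlt
    have := (concaveOn_activity hr hp₁).le_slope_of_hasDerivAt (mem_Ioi.2 hg) (mem_Ioi.2 hf) hlt
      (hasDerivAt_activity hr hp₁ hf)
    rwa [slope_def_field, le_div_iff₀ (sub_pos.2 hlt)] at this

lemma activity_le_log (hr : 3 ≤ r) (hp₀ : 0 ≤ p) (hp₁ : p < 1) (hf : 0 < f)
    (hf₁ : f ≤ 1 - p) :
    activity r p f ≤ 1 - f - ((r : ℝ) - 1)⁻¹ * Real.log ((1 - p) / f) := by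
  have hq := sub_pos.2 hp₁
  have hlog : ∫ x in f..(1 - p), ((r : ℝ) - 1)⁻¹ * x⁻¹ =
      ((r : ℝ) - 1)⁻¹ * Real.log ((1 - p) / f) := by
    rw [intervalIntegral.integral_const_mul, integral_inv_of_pos hf hq]
  have hinv : ContinuousOn (fun x : ℝ => ((r : ℝ) - 1)⁻¹ * x⁻¹) (uIcc f (1 - p)) :=
    continuousOn_const.mul <| continuousOn_inv₀.mono fun x hx =>
      ((lt_min hf hq).trans_le hx.1).ne'
  rw [← hlog]
  refine sub_le_sub_left (intervalIntegral.integral_mono_on hf₁ hinv.intervalIntegrable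
    (intervalIntegrable_inv_rate (by omega) hp₁ hf hq) fun x hx => ?_) _
  have hx₀ : 0 < x := hf.trans_le hx.1
  rw [← mul_inv]
  exact inv_anti₀ (rate_pos (by omega) hp₁ hx₀) (rate_le_mul hr hp₀ hx₀.le (by linarith [hx.2]))

lemma exists_isTerminalFraction (hr : 3 ≤ r) (hp₀ : 0 < p) (hp₁ : p < 1) :
    ∃ φ, IsTerminalFraction r p φ := by
  have hr₁ := one_le_cast_sub_one (r := r) (by omega)
  have hq := sub_pos.2 hp₁
  set a := (1 - p) * Real.exp (-(r : ℝ)) with ha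
  have ha₀ : 0 < a := by positivity
  have ha₁ : a < 1 - p := mul_lt_of_lt_one_right hq (Real.exp_lt_one_iff.2 (by linarith))
  have hneg : activity r p a < 0 := by
    have hlog : Real.log ((1 - p) / a) = r := by
      rw [ha, Real.exp_neg, div_mul_eq_div_div, div_self hq.ne', one_div, inv_inv, Real.log_exp]
    have hle := activity_le_log hr hp₀.le hp₁ ha₀ ha₁.le
    have : 1 < ((r : ℝ) - 1)⁻¹ * r := by
      rw [inv_mul_eq_div, one_lt_div (by linarith)]; linarith
    rw [hlog] at hle
    linarith
  obtain ⟨φ, hφ, h₀⟩ := intermediate_value_Ioo ha₁.le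
    ((continuousOn_activity (by omega) hp₁).mono fun x hx => ha₀.trans_le hx.1)
    (show (0 : ℝ) ∈ Ioo (activity r p a) (activity r p (1 - p)) from
      ⟨hneg, by rwa [activity_one_sub]⟩)
  exact ⟨φ, ha₀.trans hφ.1, hφ.2, h₀⟩

lemma IsTerminalFraction.rate_lt_one (h : IsTerminalFraction r p φ) (hr : 2 ≤ r) (hp₀ : 0 < p) :
    rate r p φ < 1 := by
  have htangent := activity_sub_le hr h.lt_one h.pos h.lt_init.le
  rw [activity_one_sub, h.activity_eq_zero, sub_zero] at htangent
  have hslope : 0 < -1 + (rate r p φ)⁻¹ :=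
    pos_of_mul_pos_left (hp₀.trans_le htangent) (sub_pos.2 h.lt_init).le
  exact (one_lt_inv₀ (rate_pos hr h.lt_one h.pos)).1 (by linarith)

lemma IsTerminalFraction.strictMonoOn_activity (h : IsTerminalFraction r p φ) (hr : 2 ≤ r)
    (hp₀ : 0 < p) : StrictMonoOn (activity r p) (Ioc 0 φ) := by
  apply strictMonoOn_of_deriv_pos (convex_Ioc _ _)
    ((continuousOn_activity hr h.lt_one).mono fun x hx => hx.1)
  intro x hx
  rw [interior_Ioc] at hx
  rw [(hasDerivAt_activity hr h.lt_one hx.1).deriv]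
  have := (one_lt_inv₀ (rate_pos hr h.lt_one h.pos)).2 (h.rate_lt_one hr hp₀)
  linarith [inv_rate_anti hr h.lt_one hx.1 hx.2.le]

lemma IsTerminalFraction.activity_pos (h : IsTerminalFraction r p φ) (hr : 2 ≤ r) (hp₀ : 0 < p)
    (hf : f ∈ Ioc φ (1 - p)) : 0 < activity r p f := by
  have hslope := (concaveOn_activity hr h.lt_one).antitoneOn_slope_gt (mem_Ioi.2 h.pos)
    ⟨mem_Ioi.2 (h.pos.trans hf.1), hf.1⟩ ⟨mem_Ioi.2 (sub_pos.2 h.lt_one), h.lt_init⟩ hf.2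
  simp only [slope_def_field, h.activity_eq_zero, activity_one_sub, sub_zero] at hslope
  have hpos := (div_pos hp₀ (sub_pos.2 h.lt_init)).trans_le hslope
  exact (div_pos_iff_of_pos_right (sub_pos.2 hf.1)).1 hpos

lemma IsTerminalFraction.mem_Ioo (h : IsTerminalFraction r p φ) (hr : 2 ≤ r) (hp₀ : 0 < p)
    (hf₁ : f ≤ 1 - p) (hf : activity r p f < 0) (hg₀ : 0 < g) (hg : 0 < activity r p g) :
    φ ∈ Ioo f g := by
  constructor
  · by_contra! hle
    rcases hle.eq_or_lt with rfl | hlt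
    · exact hf.ne h.activity_eq_zero
    · exact hf.not_gt (h.activity_pos hr hp₀ ⟨hlt, hf₁⟩)
  · by_contra! hle
    have := (h.strictMonoOn_activity hr hp₀).monotoneOn ⟨hg₀, hle⟩ ⟨h.pos, le_rfl⟩ hle
    exact hg.not_ge (this.trans_eq h.activity_eq_zero)

lemma xiVal_le_three (hr : 2 ≤ r) (hp₀ : 0 < p) (hφ₀ : 0 < φ) (hφ₁ : φ < 1 - p) :
    xiVal r p φ ≤ 3 := by
  have hr₁ := one_le_cast_sub_one hr
  have hq₁ : 1 - p ≤ 1 := by linarith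
  have hcoef : (r : ℝ) / (2 * ((r : ℝ) - 1)) ≤ 1 := by
    rw [div_le_one (by linarith)]; linarith
  have hfirst : p * (1 - p) ^ r ≤ 1 :=
    mul_le_one₀ (by linarith) (pow_nonneg (by linarith) _) (pow_le_one₀ (by linarith) hq₁)
  have hsecond : (r : ℝ) / (2 * ((r : ℝ) - 1)) * ((1 - p) ^ 2 - φ ^ 2) ≤ 1 :=
    mul_le_one₀ hcoef (by nlinarith) (by nlinarith)
  have hthird : (1 - p) * φ ^ r ≤ 1 :=
    mul_le_one₀ hq₁ (by positivity) (pow_le_one₀ hφ₀.le (by linarith))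
  unfold xiVal
  linarith

end Activity

section DecreasingSolutions

/-- The inverse of this order isomorphism solves `y' = 1 / Ψ(y)`. -/
lemma exists_orderIso_hasDerivAt {Ψ : ℝ → ℝ} {m : ℝ} (hΨ : Continuous Ψ) (hm : 0 < m)
    (hle : ∀ z, m ≤ Ψ z) (z₀ : ℝ) :
    ∃ e : ℝ ≃o ℝ, e z₀ = 0 ∧ ∀ z, HasDerivAt e (Ψ z) z := by
  set X : ℝ → ℝ := fun z => ∫ x in z₀..z, Ψ x
  have hX : ∀ z, HasDerivAt X (Ψ z) z := fun z =>
    intervalIntegral.integral_hasDerivAt_right (hΨ.intervalIntegrable _ _)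
      (hΨ.stronglyMeasurableAtFilter _ _) hΨ.continuousAt
  have hX₀ : X z₀ = 0 := intervalIntegral.integral_same
  have hmono : StrictMono X := strictMono_of_deriv_pos fun z => by
    rw [(hX z).deriv]; exact hm.trans_le (hle z)
  have hd : ∀ z, HasDerivAt (fun z => X z - m * z) (Ψ z - m * 1) z := fun z =>
    (hX z).sub ((hasDerivAt_id z).const_mul m)
  have hlin : Monotone fun z => X z - m * z :=
    monotone_of_deriv_nonneg (fun z => (hd z).differentiableAt) fun z => by
      rw [(hd z).deriv]; linarith [hle z]
  have htop : Tendsto X atTop atTop := by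
    refine tendsto_atTop_mono' _ ?_ (tendsto_atTop_add_const_right _ (-(m * z₀))
      (tendsto_id.const_mul_atTop hm))
    filter_upwards [eventually_ge_atTop z₀] with z hz
    have := hlin hz
    simp only [hX₀, id] at this ⊢
    linarith
  have hbot : Tendsto X atBot atBot := by
    refine tendsto_atBot_mono' _ ?_ (tendsto_atBot_add_const_right _ (-(m * z₀))
      (tendsto_id.const_mul_atBot hm))
    filter_upwards [eventually_le_atBot z₀] with z hz
    have := hlin hz
    simp only [hX₀, id] at this ⊢
    linarith
  have hcont : Continuous X := continuous_iff_continuousAt.2 fun z => (hX z).continuousAt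
  exact ⟨hmono.orderIsoOfSurjective X (hcont.surjective htop hbot), hX₀, hX⟩

lemma exists_solution_tendsto_atBot {Φ : ℝ → ℝ} {M : ℝ} (hΦ : Continuous Φ)
    (hpos : ∀ z, 0 < Φ z) (hM : ∀ z, Φ z ≤ M) (z₀ : ℝ) :
    ∃ z : ℝ → ℝ, z 0 = z₀ ∧ (∀ x, HasDerivAt z (-Φ (z x)) x) ∧ Tendsto z atTop atBot := by
  obtain ⟨e, he₀, he⟩ := exists_orderIso_hasDerivAt (hΦ.inv₀ fun z => (hpos z).ne')
    (inv_pos.2 ((hpos 0).trans_le (hM 0))) (fun z => inv_anti₀ (hpos z) (hM z)) z₀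
  have hsymm : ∀ x, HasDerivAt e.symm (Φ (e.symm x)) x := fun x =>
    (HasDerivAt.of_local_left_inverse e.symm.continuous.continuousAt (he _)
      (inv_ne_zero (hpos _).ne') (Eventually.of_forall e.apply_symm_apply)).congr_deriv
        (inv_inv _)
  refine ⟨fun x => e.symm (-x), ?_, fun x => ?_, e.symm.tendsto_atBot.comp
    tendsto_neg_atTop_atBot⟩
  · change e.symm (-0) = z₀
    rw [neg_zero, ← he₀, e.symm_apply_apply]
  · exact ((hsymm (-x)).comp x (hasDerivAt_neg x)).congr_deriv (by ring)

lemma exists_solution_tendsto_of_le_mul_sub {Ψ : ℝ → ℝ} {φ a K : ℝ} (hφa : φ < a)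
    (hΨ : ContinuousOn Ψ (Ioc φ a)) (hpos : ∀ y ∈ Ioc φ a, 0 < Ψ y)
    (hK : ∀ y ∈ Ioc φ a, Ψ y ≤ K * (y - φ)) :
    ∃ f : ℝ → ℝ, f 0 = a ∧ (∀ x, 0 ≤ x → f x ∈ Ioc φ a) ∧
      (∀ x, 0 ≤ x → HasDerivAt f (-Ψ (f x)) x) ∧ Tendsto f atTop (𝓝 φ) := by
  -- In the coordinate `z = log (f - φ)` the equation has a bounded right-hand side; it is
  -- extended past the initial value `z₀` by freezing its argument there.
  set z₀ := Real.log (a - φ)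
  have hz₀ : Real.exp z₀ = a - φ := Real.exp_log (sub_pos.2 hφa)
  set y : ℝ → ℝ := fun z => φ + Real.exp (min z z₀) with hy
  have hymem : ∀ z, y z ∈ Ioc φ a := fun z =>
    ⟨lt_add_of_pos_right _ (Real.exp_pos _), by
      linarith [Real.exp_le_exp.2 (min_le_right z z₀), hz₀]⟩
  have hΦ : Continuous fun z => Ψ (y z) / Real.exp (min z z₀) :=
    (hΨ.comp_continuous (by fun_prop) hymem).div (by fun_prop) fun z => (Real.exp_pos _).ne'
  have hΦpos : ∀ z, 0 < Ψ (y z) / Real.exp (min z z₀) := fun z =>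
    div_pos (hpos _ (hymem z)) (Real.exp_pos _)
  obtain ⟨z, hz0, hz, hlim⟩ := exists_solution_tendsto_atBot hΦ hΦpos (M := K) (fun z => by
    rw [div_le_iff₀ (Real.exp_pos _)]
    exact (hK _ (hymem z)).trans_eq (by rw [hy, add_sub_cancel_left])) z₀
  have hanti : Antitone z := antitone_of_deriv_nonpos (fun x => (hz x).differentiableAt)
    fun x => by rw [(hz x).deriv]; exact neg_nonpos.2 (hΦpos _).le
  have hmin : ∀ x, 0 ≤ x → min (z x) z₀ = z x := fun x hx => min_eq_left (hz0 ▸ hanti hx)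
  have hyz : ∀ x, 0 ≤ x → y (z x) = φ + Real.exp (z x) := fun x hx => by simp only [hy, hmin x hx]
  refine ⟨fun x => φ + Real.exp (z x), by simp only [hz0, hz₀, add_sub_cancel],
    fun x hx => by simpa only [hyz x hx] using hymem (z x), fun x hx => ?_, ?_⟩
  · refine ((hz x).exp.const_add φ).congr_deriv ?_
    rw [hyz x hx, hmin x hx, mul_neg, mul_div_cancel₀ _ (Real.exp_pos _).ne']
  · simpa using (Real.tendsto_exp_atBot.comp hlim).const_add φ

end DecreasingSolutions

/-- `f` is the surviving fraction as a function of time: the solution of the scalar equation to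
which the system reduces once the activity is expressed through its first integral. -/
structure IsSurvivalCurve (r : ℕ) (p φ : ℝ) (f : ℝ → ℝ) : Prop where
  apply_zero : f 0 = 1 - p
  mem_Ioc : ∀ x, 0 ≤ x → f x ∈ Ioc φ (1 - p)
  hasDerivAt : ∀ x, 0 ≤ x → HasDerivAt f (-(rate r p (f x) * activity r p (f x))) x
  tendsto : Tendsto f atTop (𝓝 φ)

section SurvivalCurve

variable {r : ℕ} {p φ x : ℝ} {f : ℝ → ℝ}

lemma IsTerminalFraction.exists_isSurvivalCurve (h : IsTerminalFraction r p φ) (hr : 2 ≤ r)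
    (hp₀ : 0 < p) : ∃ f, IsSurvivalCurve r p φ f := by
  have hpos : ∀ y ∈ Ioc φ (1 - p), 0 < y := fun y hy => h.pos.trans hy.1
  obtain ⟨f, h₀, hmem, hderiv, hlim⟩ := exists_solution_tendsto_of_le_mul_sub
    (Ψ := fun y => rate r p y * activity r p y) (K := rate r p (1 - p) * (rate r p φ)⁻¹) h.lt_init
    (continuous_rate.continuousOn.mul ((continuousOn_activity hr h.lt_one).mono hpos))
    (fun y hy => mul_pos (rate_pos hr h.lt_one (hpos y hy)) (h.activity_pos hr hp₀ hy))
    (fun y hy => by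
      have hact : activity r p y ≤ (rate r p φ)⁻¹ * (y - φ) := by
        have := activity_sub_le hr h.lt_one h.pos hy.1.le
        rw [h.activity_eq_zero] at this
        linarith [hy.1]
      rw [mul_assoc]
      exact mul_le_mul (rate_mono hr h.lt_one (hpos y hy).le hy.2) hact
        (h.activity_pos hr hp₀ hy).le (rate_pos hr h.lt_one (sub_pos.2 h.lt_one)).le)
  exact ⟨f, h₀, hmem, hderiv, hlim⟩

lemma hasDerivAt_pow_of_ne_zero {f' : ℝ} (hf : HasDerivAt f f' x) (hx : f x ≠ 0) (k : ℕ) :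
    HasDerivAt (fun y => f y ^ k) (k * f x ^ k * f' / f x) x := by
  refine (hf.fun_pow k).congr_deriv ?_
  cases k with
  | zero => simp
  | succ k => rw [Nat.add_sub_cancel, pow_succ]; field_simp

namespace IsSurvivalCurve

lemma pos (hf : IsSurvivalCurve r p φ f) (h : IsTerminalFraction r p φ) (hx : 0 ≤ x) :
    0 < f x :=
  h.pos.trans (hf.mem_Ioc x hx).1

lemma hasDerivAt_activity (hf : IsSurvivalCurve r p φ f) (h : IsTerminalFraction r p φ)
    (hr : 2 ≤ r) (hx : 0 ≤ x) :
    HasDerivAt (fun y => activity r p (f y))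
      (rate r p (f x) * activity r p (f x) - activity r p (f x)) x := by
  have hrate := (rate_pos hr h.lt_one (hf.pos h hx)).ne'
  refine ((InducedForest.hasDerivAt_activity hr h.lt_one (hf.pos h hx)).comp x
    (hf.hasDerivAt x hx)).congr_deriv ?_
  field_simp
  ring

lemma hasDerivAt_rate (hf : IsSurvivalCurve r p φ f) (h : IsTerminalFraction r p φ)
    (hr : 2 ≤ r) (hx : 0 ≤ x) :
    HasDerivAt (fun y => rate r p (f y))
      (-(((r : ℝ) - 2) * rate r p (f x) ^ 2 * activity r p (f x) / f x)) x := by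
  refine ((hasDerivAt_pow_of_ne_zero (hf.hasDerivAt x hx) (hf.pos h hx).ne' (r - 2)).const_mul
    ((1 - p) * ((r : ℝ) - 1))).congr_deriv ?_
  rw [Nat.cast_sub hr, rate]
  push_cast
  ring

lemma hasDerivAt_rate_mul_activity (hf : IsSurvivalCurve r p φ f) (h : IsTerminalFraction r p φ)
    (hr : 2 ≤ r) (hx : 0 ≤ x) :
    HasDerivAt (fun y => rate r p (f y) * activity r p (f y))
      (rate r p (f x) * activity r p (f x) * (-1 + rate r p (f x)
        - ((r : ℝ) - 2) * rate r p (f x) * activity r p (f x) / f x)) x :=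
  ((hf.hasDerivAt_rate h hr hx).mul (hf.hasDerivAt_activity h hr hx)).congr_deriv (by ring)

end IsSurvivalCurve

end SurvivalCurve

section ClosedForm

variable {r : ℕ} {p φ x : ℝ} {f : ℝ → ℝ}

lemma mul_div_eq_rate {y : ℝ} (hr : 2 ≤ r) (hp₁ : p < 1) (hy : 0 < y) :
    ((r : ℝ) - 1) * ((1 - p) ^ 2 * y ^ (2 * (r - 1))) / ((1 - p) * y ^ r) = rate r p y := by
  obtain ⟨n, rfl⟩ := Nat.exists_eq_add_of_le' hr
  have := (sub_pos.2 hp₁).ne'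
  simp only [rate, Nat.add_sub_cancel, show n + 2 - 1 = n + 1 by omega]
  field_simp
  ring

namespace IsSurvivalCurve

lemma deriv_w (hf : IsSurvivalCurve r p φ f) (h : IsTerminalFraction r p φ) (hr : 2 ≤ r)
    (hx : 0 ≤ x) :
    HasDerivAt (fun y => (1 - p) * f y ^ r)
      (-(r : ℝ) * ((1 - p) * f x ^ (r - 1) * (rate r p (f x) * activity r p (f x)))) x := by
  have hfx := (hf.pos h hx).ne'
  refine ((hasDerivAt_pow_of_ne_zero (hf.hasDerivAt x hx) hfx r).const_mul
    (1 - p)).congr_deriv ?_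
  rw [← mul_pow_sub_one (show r ≠ 0 by omega) (f x)]
  field_simp

lemma deriv_b (hf : IsSurvivalCurve r p φ f) (h : IsTerminalFraction r p φ) (hr : 2 ≤ r)
    (hx : 0 ≤ x) :
    HasDerivAt (fun y => (1 - p) * r * f y ^ (r - 1) * activity r p (f y))
      (-((1 - p) * r * f x ^ (r - 1) * activity r p (f x))
        - r * (rate r p (f x) * activity r p (f x)) ^ 2
        + r * ((1 - p) * f x ^ (r - 1) * (rate r p (f x) * activity r p (f x)))) x := by
  have hfx := (hf.pos h hx).ne'
  refine (((hasDerivAt_pow_of_ne_zero (hf.hasDerivAt x hx) hfx (r - 1)).const_mul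
    ((1 - p) * r)).mul (hf.hasDerivAt_activity h hr hx)).congr_deriv ?_
  obtain ⟨n, rfl⟩ := Nat.exists_eq_add_of_le' hr
  simp only [rate, Nat.add_sub_cancel, show n + 2 - 1 = n + 1 by omega]
  push_cast
  field_simp
  ring

lemma deriv_q (hf : IsSurvivalCurve r p φ f) (h : IsTerminalFraction r p φ) (hr : 2 ≤ r)
    (hx : 0 ≤ x) :
    HasDerivAt (fun y => (1 - p) ^ 2 * f y ^ (2 * (r - 1)))
      (-((2 * (r : ℝ) - 2) * ((1 - p) ^ 2 * f x ^ (2 * (r - 1)))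
        * ((1 - p) * f x ^ (r - 1) * (rate r p (f x) * activity r p (f x)))
        / ((1 - p) * f x ^ r))) x := by
  have hfx := (hf.pos h hx).ne'
  have hq := (sub_pos.2 h.lt_one).ne'
  refine ((hasDerivAt_pow_of_ne_zero (hf.hasDerivAt x hx) hfx (2 * (r - 1))).const_mul
    ((1 - p) ^ 2)).congr_deriv ?_
  rw [← mul_pow_sub_one (show r ≠ 0 by omega) (f x), Nat.cast_mul, Nat.cast_sub (by omega)]
  push_cast
  field_simp

lemma deriv_s (hf : IsSurvivalCurve r p φ f) (h : IsTerminalFraction r p φ) (hr : 2 ≤ r)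
    (hp₀ : 0 < p) (hx : 0 ≤ x) :
    HasDerivAt (fun y => (1 - p) * f y ^ (r - 1) * (rate r p (f y) * activity r p (f y)))
      (-((1 - p) * f x ^ (r - 1) * (rate r p (f x) * activity r p (f x)))
        + ((r : ℝ) - 1) * ((1 - p) ^ 2 * f x ^ (2 * (r - 1)))
          * ((1 - p) * f x ^ (r - 1) * (rate r p (f x) * activity r p (f x)))
          / ((1 - p) * f x ^ r)
        - ((r : ℝ) - 1) * ((1 - p) * f x ^ (r - 1) * (rate r p (f x) * activity r p (f x))) ^ 2
          / ((1 - p) * f x ^ r)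
        - (r : ℝ) * ((r : ℝ) - 2)
          * ((1 - p) * f x ^ (r - 1) * (rate r p (f x) * activity r p (f x)))
          * (rate r p (f x) * activity r p (f x)) ^ 2
          / (((r : ℝ) - 1) * ((1 - p) * r * f x ^ (r - 1) * activity r p (f x)))) x := by
  have hfx := (hf.pos h hx).ne'
  have hq := (sub_pos.2 h.lt_one).ne'
  have hact := (h.activity_pos hr hp₀ (hf.mem_Ioc x hx)).ne'
  have hr₁ : (r : ℝ) - 1 ≠ 0 := by linarith [one_le_cast_sub_one hr]
  refine (((hasDerivAt_pow_of_ne_zero (hf.hasDerivAt x hx) hfx (r - 1)).const_mul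
    (1 - p)).mul (hf.hasDerivAt_rate_mul_activity h hr hx)).congr_deriv ?_
  obtain ⟨n, rfl⟩ := Nat.exists_eq_add_of_le' hr
  simp only [rate, Nat.add_sub_cancel, show n + 2 - 1 = n + 1 by omega] at hr₁ ⊢
  push_cast at hr₁ ⊢
  field_simp
  ring

lemma deriv_t (hf : IsSurvivalCurve r p φ f) (h : IsTerminalFraction r p φ) (hr : 2 ≤ r)
    (hp₀ : 0 < p) (hx : 0 ≤ x) :
    HasDerivAt (fun y => (rate r p (f y) * activity r p (f y)) ^ 2)
      (-2 * (rate r p (f x) * activity r p (f x)) ^ 2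
        + 2 * ((r : ℝ) - 1) * ((1 - p) * f x ^ (r - 1) * (rate r p (f x) * activity r p (f x))) ^ 2
          / ((1 - p) * f x ^ r)
        - 2 * (r : ℝ) * ((r : ℝ) - 2) * ((rate r p (f x) * activity r p (f x)) ^ 2) ^ 2
          / (((r : ℝ) - 1) * ((1 - p) * r * f x ^ (r - 1) * activity r p (f x)))) x := by
  have hfx := (hf.pos h hx).ne'
  have hq := (sub_pos.2 h.lt_one).ne'
  have hact := (h.activity_pos hr hp₀ (hf.mem_Ioc x hx)).ne'
  have hr₁ : (r : ℝ) - 1 ≠ 0 := by linarith [one_le_cast_sub_one hr]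
  refine ((hf.hasDerivAt_rate_mul_activity h hr hx).fun_pow 2).congr_deriv ?_
  obtain ⟨n, rfl⟩ := Nat.exists_eq_add_of_le' hr
  simp only [rate, Nat.add_sub_cancel, show n + 2 - 1 = n + 1 by omega] at hr₁ ⊢
  push_cast at hr₁ ⊢
  field_simp
  ring

lemma isSolution (hf : IsSurvivalCurve r p φ f) (h : IsTerminalFraction r p φ) (hr : 2 ≤ r)
    (hp₀ : 0 < p) :
    IsSolution r p (fun x => (1 - p) * f x ^ r)
      (fun x => (1 - p) * r * f x ^ (r - 1) * activity r p (f x))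
      (fun x => (1 - p) ^ 2 * f x ^ (2 * (r - 1)))
      (fun x => (1 - p) * f x ^ (r - 1) * (rate r p (f x) * activity r p (f x)))
      (fun x => (rate r p (f x) * activity r p (f x)) ^ 2) where
  pos x hx := by
    have hq := sub_pos.2 h.lt_one
    have hfx := hf.pos h hx
    have hrate := rate_pos hr h.lt_one hfx
    have hact := h.activity_pos hr hp₀ (hf.mem_Ioc x hx)
    exact ⟨by positivity, by positivity, by positivity, by positivity, by positivity⟩
  deriv_w _ hx := (hf.deriv_w h hr hx).hasDerivWithinAt
  deriv_b _ hx := (hf.deriv_b h hr hx).hasDerivWithinAt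
  deriv_q _ hx := (hf.deriv_q h hr hx).hasDerivWithinAt
  deriv_s _ hx := (hf.deriv_s h hr hp₀ hx).hasDerivWithinAt
  deriv_t _ hx := (hf.deriv_t h hr hp₀ hx).hasDerivWithinAt
  init_w := by rw [hf.apply_zero, ← pow_succ']
  init_b := by
    rw [hf.apply_zero, activity_one_sub, ← mul_pow_sub_one (show r ≠ 0 by omega) (1 - p)]
    ring
  init_q := by rw [hf.apply_zero, ← pow_add, show 2 + 2 * (r - 1) = 2 * r by omega]
  init_s := by
    rw [hf.apply_zero, activity_one_sub, rate,
      show 2 * r - 1 = 1 + (r - 1) + (1 + (r - 2)) by omega]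
    ring
  init_t := by
    rw [hf.apply_zero, activity_one_sub, rate, show 2 * r - 2 = 2 + (r - 2) * 2 by omega]
    ring

lemma hasDerivAt_neg_sq (hf : IsSurvivalCurve r p φ f) (hr : 2 ≤ r) (hx : 0 ≤ x) :
    HasDerivAt (fun y => -((r : ℝ) / (2 * ((r : ℝ) - 1))) * f y ^ 2)
      ((1 - p) * r * f x ^ (r - 1) * activity r p (f x)) x := by
  have hr₁ : (r : ℝ) - 1 ≠ 0 := by linarith [one_le_cast_sub_one hr]
  refine (((hf.hasDerivAt x hx).fun_pow 2).const_mul _).congr_deriv ?_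
  rw [show r - 1 = r - 2 + 1 by omega, rate]
  field_simp
  ring

lemma isXi (hf : IsSurvivalCurve r p φ f) (h : IsTerminalFraction r p φ) (hr : 2 ≤ r)
    (hp₀ : 0 < p) : IsXi r p (xiVal r p φ) := by
  have hsol := hf.isSolution h hr hp₀
  have hderiv := fun x (hx : x ∈ Ici (0 : ℝ)) => hf.hasDerivAt_neg_sq hr hx
  have hnonneg := fun x (hx : x ∈ Ioi (0 : ℝ)) => (hsol.pos x (le_of_lt hx)).2.1.le
  have hlim := (hf.tendsto.pow 2).const_mul (-((r : ℝ) / (2 * ((r : ℝ) - 1))))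
  refine ⟨_, _, _, _, _, hsol, integrableOn_Ioi_deriv_of_nonneg' hderiv hnonneg hlim,
    (1 - p) * φ ^ r, rate r p φ, (hf.tendsto.pow r).const_mul _, ?_, ?_⟩
  · refine ((continuous_rate.tendsto φ).comp hf.tendsto).congr' ?_
    filter_upwards [eventually_ge_atTop 0] with x hx
    exact (mul_div_eq_rate hr h.lt_one (hf.pos h hx)).symm
  · rw [if_pos (h.rate_lt_one hr hp₀),
      integral_Ioi_of_hasDerivAt_of_nonneg' hderiv hnonneg hlim, hf.apply_zero, xiVal]
    ring

end IsSurvivalCurve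

lemma IsTerminalFraction.isXi (h : IsTerminalFraction r p φ) (hr : 2 ≤ r) (hp₀ : 0 < p) :
    IsXi r p (xiVal r p φ) := by
  obtain ⟨f, hf⟩ := h.exists_isSurvivalCurve hr hp₀
  exact hf.isXi h hr hp₀

end ClosedForm

lemma eqOn_Ici_of_locallyLipschitzOn {E : Type*} [NormedAddCommGroup E] [NormedSpace ℝ E]
    {v : E → E} {U : Set E} {F G : ℝ → E} (hv : LocallyLipschitzOn U v)
    (hF : ∀ x, 0 ≤ x → HasDerivWithinAt F (v (F x)) (Ici 0) x) (hFU : ∀ x, 0 ≤ x → F x ∈ U)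
    (hG : ∀ x, 0 ≤ x → HasDerivWithinAt G (v (G x)) (Ici 0) x) (hGU : ∀ x, 0 ≤ x → G x ∈ U)
    (h₀ : F 0 = G 0) : EqOn F G (Ici 0) := by
  intro x hx
  have hcont : ∀ {H : ℝ → E}, (∀ x, 0 ≤ x → HasDerivWithinAt H (v (H x)) (Ici 0) x) →
      ContinuousOn H (Icc 0 x) := fun hH y hy =>
    (hH y hy.1).continuousWithinAt.mono Icc_subset_Ici_self
  have hcompact : IsCompact (F '' Icc 0 x ∪ G '' Icc 0 x) :=
    (isCompact_Icc.image_of_continuousOn (hcont hF)).union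
      (isCompact_Icc.image_of_continuousOn (hcont hG))
  have hsub : F '' Icc 0 x ∪ G '' Icc 0 x ⊆ U :=
    union_subset (image_subset_iff.2 fun y hy => hFU y hy.1)
      (image_subset_iff.2 fun y hy => hGU y hy.1)
  obtain ⟨K, hK⟩ := (hv.mono hsub).exists_lipschitzOnWith_of_compact hcompact
  exact ODE_solution_unique_of_mem_Icc_right (v := fun _ => v)
    (s := fun _ => F '' Icc 0 x ∪ G '' Icc 0 x) (fun _ _ => hK)
    (hcont hF) (fun y hy => (hF y hy.1).mono (Ici_subset_Ici.2 hy.1))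
    (fun y hy => Or.inl (mem_image_of_mem F (Ico_subset_Icc_self hy)))
    (hcont hG) (fun y hy => (hG y hy.1).mono (Ici_subset_Ici.2 hy.1))
    (fun y hy => Or.inr (mem_image_of_mem G (Ico_subset_Icc_self hy))) h₀ (right_mem_Icc.2 hx)

/-- The right-hand side of the system, on the quintuples `(w, b, q, s, t)`. -/
def field (r : ℕ) : ℝ × ℝ × ℝ × ℝ × ℝ → ℝ × ℝ × ℝ × ℝ × ℝ := fun (w, b, q, s, t) =>
  (-(r : ℝ) * s,
    -b - r * t + r * s,
    -((2 * (r : ℝ) - 2) * q * s / w),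
    -s + ((r : ℝ) - 1) * q * s / w - ((r : ℝ) - 1) * s ^ 2 / w
      - (r : ℝ) * ((r : ℝ) - 2) * s * t / (((r : ℝ) - 1) * b),
    -2 * t + 2 * ((r : ℝ) - 1) * s ^ 2 / w
      - 2 * (r : ℝ) * ((r : ℝ) - 2) * t ^ 2 / (((r : ℝ) - 1) * b))

section Uniqueness

variable {r : ℕ} {p φ c c' : ℝ} {w b q s t w' b' q' s' t' : ℝ → ℝ}

lemma locallyLipschitzOn_field (hr : 2 ≤ r) :
    LocallyLipschitzOn {y : ℝ × ℝ × ℝ × ℝ × ℝ | 0 < y.1 ∧ 0 < y.2.1} (field r) := by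
  have hconv : Convex ℝ {y : ℝ × ℝ × ℝ × ℝ × ℝ | 0 < y.1 ∧ 0 < y.2.1} :=
    ((convex_Ioi 0).linear_preimage (LinearMap.fst ℝ ℝ _)).inter
      ((convex_Ioi 0).linear_preimage (LinearMap.fst ℝ ℝ _ ∘ₗ LinearMap.snd ℝ ℝ _))
  refine ContDiffOn.locallyLipschitzOn hconv ?_
  have hw : ∀ y ∈ {y : ℝ × ℝ × ℝ × ℝ × ℝ | 0 < y.1 ∧ 0 < y.2.1}, y.1 ≠ 0 := fun y hy => hy.1.ne'
  have hb : ∀ y ∈ {y : ℝ × ℝ × ℝ × ℝ × ℝ | 0 < y.1 ∧ 0 < y.2.1}, ((r : ℝ) - 1) * y.2.1 ≠ 0 :=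
    fun y hy => mul_ne_zero (by linarith [one_le_cast_sub_one hr]) hy.2.ne'
  unfold field
  fun_prop (disch := assumption)

lemma IsSolution.hasDerivWithinAt (h : IsSolution r p w b q s t) (x : ℝ) (hx : 0 ≤ x) :
    HasDerivWithinAt (fun x => (w x, b x, q x, s x, t x))
      (field r (w x, b x, q x, s x, t x)) (Ici 0) x :=
  (h.deriv_w x hx).prodMk ((h.deriv_b x hx).prodMk ((h.deriv_q x hx).prodMk
    ((h.deriv_s x hx).prodMk (h.deriv_t x hx))))

lemma IsSolution.eqOn (h : IsSolution r p w b q s t) (h' : IsSolution r p w' b' q' s' t')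
    (hr : 2 ≤ r) : EqOn w w' (Ici 0) ∧ EqOn b b' (Ici 0) ∧ EqOn q q' (Ici 0) := by
  have heq := eqOn_Ici_of_locallyLipschitzOn (locallyLipschitzOn_field hr)
    h.hasDerivWithinAt (fun x hx => ⟨(h.pos x hx).1, (h.pos x hx).2.1⟩)
    h'.hasDerivWithinAt (fun x hx => ⟨(h'.pos x hx).1, (h'.pos x hx).2.1⟩)
    (by simp only [h.init_w, h.init_b, h.init_q, h.init_s, h.init_t, h'.init_w, h'.init_b,
      h'.init_q, h'.init_s, h'.init_t])
  simp only [EqOn, Prod.mk.injEq] at heq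
  exact ⟨fun x hx => (heq hx).1, fun x hx => (heq hx).2.1, fun x hx => (heq hx).2.2.1⟩

lemma IsXi.unique (h : IsXi r p c) (h' : IsXi r p c') (hr : 2 ≤ r) : c = c' := by
  obtain ⟨w, b, q, s, t, hsol, -, wlim, ρ, hwlim, hρ, rfl⟩ := h
  obtain ⟨w', b', q', s', t', hsol', -, wlim', ρ', hwlim', hρ', rfl⟩ := h'
  obtain ⟨hw, hb, hq⟩ := hsol.eqOn hsol' hr
  have hwlim_eq : wlim = wlim' := tendsto_nhds_unique_of_eventuallyEq hwlim hwlim' <| by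
    filter_upwards [eventually_ge_atTop 0] with x hx using hw hx
  have hρ_eq : ρ = ρ' := tendsto_nhds_unique_of_eventuallyEq hρ hρ' <| by
    filter_upwards [eventually_ge_atTop 0] with x hx
    rw [hw hx, hq hx]
  rw [hwlim_eq, hρ_eq, setIntegral_congr_fun measurableSet_Ioi (hb.mono Ioi_subset_Ici_self)]

lemma IsTerminalFraction.eq_xiVal_of_isXi (h : IsTerminalFraction r p φ) (hr : 2 ≤ r)
    (hp₀ : 0 < p) (hc : IsXi r p c) : c = xiVal r p φ :=
  hc.unique (h.isXi hr hp₀) hr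

lemma existsUnique_isXi (hr : 3 ≤ r) (hp₀ : 0 < p) (hp₁ : p < 1) : ∃! c, IsXi r p c := by
  obtain ⟨φ, h⟩ := exists_isTerminalFraction hr hp₀ hp₁
  exact ⟨_, h.isXi (by omega) hp₀, fun _ hc => h.eq_xiVal_of_isXi (by omega) hp₀ hc⟩

lemma isLUB_xi (hr : 3 ≤ r) : IsLUB (xiValues r) (xi r) := by
  refine isLUB_csSup ?_ ⟨3, ?_⟩
  · obtain ⟨c, hc, -⟩ := existsUnique_isXi (p := 1 / 2) hr (by norm_num) (by norm_num)
    exact ⟨c, 1 / 2, by norm_num, hc⟩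
  · rintro c ⟨p, ⟨hp₀, hp₁⟩, hc⟩
    obtain ⟨φ, h⟩ := exists_isTerminalFraction hr hp₀ hp₁
    rw [h.eq_xiVal_of_isXi (by omega) hp₀ hc]
    exact xiVal_le_three (by omega) hp₀ h.pos h.lt_init

end Uniqueness

section Table

variable {r : ℕ} {p φ lo hi c d f : ℝ}

lemma activity_three (hp₁ : p < 1) (hf : 0 < f) :
    activity 3 p f = 1 - f - (2 * (1 - p))⁻¹ * Real.log ((1 - p) / f) := by
  have hrate : (fun x => (rate 3 p x)⁻¹) = fun x => (2 * (1 - p))⁻¹ * x⁻¹ := by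
    funext x
    norm_num [rate]
    ring
  rw [activity, hrate, intervalIntegral.integral_const_mul,
    integral_inv_of_pos hf (sub_pos.2 hp₁)]

lemma activity_add_four (n : ℕ) (hp₁ : p < 1) (hf : 0 < f) :
    activity (n + 4) p f = 1 - f -
      ((f ^ (n + 1))⁻¹ - ((1 - p) ^ (n + 1))⁻¹) / ((n + 1) * (n + 3) * (1 - p)) := by
  have hq := sub_pos.2 hp₁
  have hrate : (fun x => (rate (n + 4) p x)⁻¹) =
      fun x => ((n + 3) * (1 - p))⁻¹ * x ^ (-((n + 2 : ℕ) : ℤ)) := by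
    funext x
    rw [zpow_neg, zpow_natCast, ← mul_inv, rate, show n + 4 - 2 = n + 2 by omega]
    push_cast
    ring
  rw [activity, hrate, intervalIntegral.integral_const_mul,
    integral_zpow (Or.inr ⟨by omega, fun h => (lt_min hf hq).not_ge h.1⟩),
    show -((n + 2 : ℕ) : ℤ) + 1 = -((n + 1 : ℕ) : ℤ) by push_cast; ring, zpow_neg, zpow_neg,
    zpow_natCast, zpow_natCast]
  push_cast
  rw [show -((n : ℝ) + 2) + 1 = -(n + 1) by ring]
  field_simp
  ring

lemma xiVal_mem_Icc (h : φ ∈ Ioo lo hi) (hr : 2 ≤ r) (hp₁ : p < 1)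
    (hlo₀ : 0 < lo) :
    xiVal r p φ ∈ Icc
      (p * (1 - p) ^ r + (r : ℝ) / (2 * ((r : ℝ) - 1)) * ((1 - p) ^ 2 - hi ^ 2) + (1 - p) * lo ^ r)
      (p * (1 - p) ^ r + (r : ℝ) / (2 * ((r : ℝ) - 1)) * ((1 - p) ^ 2 - lo ^ 2)
        + (1 - p) * hi ^ r) := by
  have hcoef : 0 ≤ (r : ℝ) / (2 * ((r : ℝ) - 1)) :=
    div_nonneg r.cast_nonneg (by linarith [one_le_cast_sub_one hr])
  have : 0 ≤ 1 - p := by linarith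
  have hφ : 0 ≤ φ := (hlo₀.trans h.1).le
  have hlo := h.1.le
  have hhi := h.2.le
  constructor <;> unfold xiVal <;> gcongr

lemma exists_isXi_of_bracket (hr : 3 ≤ r) (hp₀ : 0 < p) (hlo₀ : 0 < lo)
    (hlohi : lo < hi) (hhi₁ : hi < 1 - p) (hlo : activity r p lo < 0)
    (hhi : 0 < activity r p hi)
    (hc : c ≤ p * (1 - p) ^ r + (r : ℝ) / (2 * ((r : ℝ) - 1)) * ((1 - p) ^ 2 - hi ^ 2)
      + (1 - p) * lo ^ r)
    (hd : p * (1 - p) ^ r + (r : ℝ) / (2 * ((r : ℝ) - 1)) * ((1 - p) ^ 2 - lo ^ 2)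
      + (1 - p) * hi ^ r < d) :
    ∃ p₀ ∈ Ioo (0 : ℝ) 1, ∃ c', IsXi r p₀ c' ∧ c ≤ c' ∧ c' < d := by
  have hp₁ : p < 1 := by linarith
  have hr₂ : 2 ≤ r := by omega
  obtain ⟨φ, h⟩ := exists_isTerminalFraction hr hp₀ hp₁
  have hφ := h.mem_Ioo hr₂ hp₀ (by linarith) hlo (hlo₀.trans hlohi) hhi
  have hxi := xiVal_mem_Icc hφ hr₂ hp₁ hlo₀
  exact ⟨p, ⟨hp₀, hp₁⟩, _, h.isXi hr₂ hp₀, hc.trans hxi.1, hxi.2.trans_lt hd⟩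

lemma mul_log_mem_Icc {y : ℝ} (hy : 0 < y) (k m : ℕ) :
    k * Real.log y ∈ Icc (m * Real.log 2 + (1 - 2 ^ m / y ^ k))
      (m * Real.log 2 + (y ^ k / 2 ^ m - 1)) := by
  have hlog : Real.log (y ^ k / 2 ^ m) = k * Real.log y - m * Real.log 2 := by
    rw [Real.log_div (by positivity) (by positivity), Real.log_pow, Real.log_pow]
  have hpos : 0 < y ^ k / 2 ^ m := by positivity
  have hle := Real.log_le_sub_one_of_pos hpos
  have hge := Real.one_sub_inv_le_log_of_pos hpos
  rw [inv_div] at hge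
  constructor <;> linarith

lemma exists_isXi_table_three :
    ∃ p₀ ∈ Ioo (0 : ℝ) 1, ∃ c, IsXi 3 p₀ c ∧ tableXi 3 ≤ c ∧ c < tableXi 3 + 0.0001 := by
  -- `((1 - p) / φ) ^ 27` is close to `2 ^ 62`
  refine exists_isXi_of_bracket (p := 0.001) (lo := 0.20337) (hi := 0.20341) le_rfl (by norm_num)
    (by norm_num) (by norm_num) (by norm_num) ?_ ?_
    (by norm_num [tableXi]) (by norm_num [tableXi]) <;>
    rw [activity_three (by norm_num) (by norm_num)]
  · have hlog := (mul_log_mem_Icc (y := (1 - 0.001) / 0.20337) (by norm_num) 27 62).1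
    have := Real.log_two_gt_d9
    norm_num at hlog this ⊢
    linarith
  · have hlog := (mul_log_mem_Icc (y := (1 - 0.001) / 0.20341) (by norm_num) 27 62).2
    have := Real.log_two_lt_d9
    norm_num at hlog this ⊢
    linarith

lemma exists_isXi_add_four (n : ℕ) (hp₀ : 0 < p) (hlo₀ : 0 < lo)
    (hlohi : lo < hi) (hhi₁ : hi < 1 - p)
    (hlo : 1 - lo <
      ((lo ^ (n + 1))⁻¹ - ((1 - p) ^ (n + 1))⁻¹) / ((n + 1) * (n + 3) * (1 - p)))
    (hhi : ((hi ^ (n + 1))⁻¹ - ((1 - p) ^ (n + 1))⁻¹) / ((n + 1) * (n + 3) * (1 - p)) < 1 - hi)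
    (hc : c ≤ p * (1 - p) ^ (n + 4)
      + ((n : ℝ) + 4) / (2 * ((n : ℝ) + 3)) * ((1 - p) ^ 2 - hi ^ 2) + (1 - p) * lo ^ (n + 4))
    (hd : p * (1 - p) ^ (n + 4) + ((n : ℝ) + 4) / (2 * ((n : ℝ) + 3)) * ((1 - p) ^ 2 - lo ^ 2)
      + (1 - p) * hi ^ (n + 4) < d) :
    ∃ p₀ ∈ Ioo (0 : ℝ) 1, ∃ c', IsXi (n + 4) p₀ c' ∧ c ≤ c' ∧ c' < d := by
  have hcast : ((n + 4 : ℕ) : ℝ) / (2 * (((n + 4 : ℕ) : ℝ) - 1)) = (n + 4) / (2 * (n + 3)) := by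
    push_cast; ring
  refine exists_isXi_of_bracket (by omega) hp₀ hlo₀ hlohi hhi₁ ?_ ?_ (hcast ▸ hc) (hcast ▸ hd)
  · rw [activity_add_four n (by linarith) hlo₀]; linarith
  · rw [activity_add_four n (by linarith) (hlo₀.trans hlohi)]; linarith

lemma exists_isXi_table (hr : 3 ≤ r) (hr₁₀ : r ≤ 10) :
    ∃ p₀ ∈ Ioo (0 : ℝ) 1, ∃ c, IsXi r p₀ c ∧ tableXi r ≤ c ∧ c < tableXi r + 0.0001 := by
  interval_cases r
  · exact exists_isXi_table_three
  · apply exists_isXi_add_four 0 (p := 0.001) (lo := 0.33349) (hi := 0.33351) <;>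
      norm_num [tableXi]
  · apply exists_isXi_add_four 1 (p := 0.001) (lo := 0.42167) (hi := 0.42168) <;>
      norm_num [tableXi]
  · apply exists_isXi_add_four 2 (p := 0.001) (lo := 0.48615) (hi := 0.48617) <;>
      norm_num [tableXi]
  · apply exists_isXi_add_four 3 (p := 0.001) (lo := 0.53579) (hi := 0.53581) <;>
      norm_num [tableXi]
  · apply exists_isXi_add_four 4 (p := 0.001) (lo := 0.57542) (hi := 0.57544) <;>
      norm_num [tableXi]
  · apply exists_isXi_add_four 5 (p := 0.0007) (lo := 0.60792) (hi := 0.60793) <;>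
      norm_num [tableXi]
  · apply exists_isXi_add_four 6 (p := 0.001) (lo := 0.63520) (hi := 0.63521) <;>
      norm_num [tableXi]

end Table

/-- The Euler discretisation, with step size `ε`, of the evolution of the pair (surviving fraction,
active fraction). -/
def fracs (r : ℕ) (p ε : ℝ) : ℕ → ℝ × ℝ
  | 0 => (1 - p, p)
  | i + 1 => ((fracs r p ε i).1 - ε * (rate r p (fracs r p ε i).1 * (fracs r p ε i).2),
      (1 - ε) * (fracs r p ε i).2 + ε * (rate r p (fracs r p ε i).1 * (fracs r p ε i).2))

/-- The surviving fraction of branches after `i` steps of size `ε`. -/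
def surv (r : ℕ) (p ε : ℝ) (i : ℕ) : ℝ := (fracs r p ε i).1

/-- The active fraction of branches after `i` steps of size `ε`. -/
def act (r : ℕ) (p ε : ℝ) (i : ℕ) : ℝ := (fracs r p ε i).2

/-- The step sizes for which the discretised fractions remain probabilities. -/
structure IsStepSize (r : ℕ) (ε : ℝ) : Prop where
  pos : 0 < ε
  mul_lt_one : ε * ((r : ℝ) - 1) < 1

/-- A lower bound for the expected density of the forest selected by `N` rounds of size `ε`. In the
last term, `r * rate ^ k` bounds the density of surviving vertices whose component of surviving
vertices reaches distance `k`. -/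
def density (r : ℕ) (p ε : ℝ) (N k : ℕ) : ℝ :=
  p * (1 - p) ^ r +
    (1 - ε) ^ r * ∑ i ∈ Finset.range N, ε * ((1 - p) * r * act r p ε i * surv r p ε i ^ (r - 1)) +
    ((1 - p) * surv r p ε N ^ r - r * rate r p (surv r p ε N) ^ k)

section Discretisation

variable {r : ℕ} {p ε φ δ η : ℝ} {i N k : ℕ}

lemma IsStepSize.lt_one (hε : IsStepSize r ε) (hr : 2 ≤ r) : ε < 1 := by
  nlinarith [hε.pos, hε.mul_lt_one, one_le_cast_sub_one hr]

@[simp] lemma surv_zero : surv r p ε 0 = 1 - p := rfl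

@[simp] lemma act_zero : act r p ε 0 = p := rfl

lemma surv_succ (i : ℕ) : surv r p ε (i + 1) =
    surv r p ε i - ε * (rate r p (surv r p ε i) * act r p ε i) := rfl

lemma act_succ (i : ℕ) : act r p ε (i + 1) =
    (1 - ε) * act r p ε i + (surv r p ε i - surv r p ε (i + 1)) := by
  rw [surv_succ, sub_sub_cancel]; rfl

lemma surv_act_bounds (hr : 3 ≤ r) (hp₀ : 0 < p) (hp₁ : p < 1) (hε : IsStepSize r ε) (i : ℕ) :
    0 < surv r p ε i ∧ 0 ≤ act r p ε i ∧ surv r p ε i + act r p ε i ≤ 1 := by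
  have hr₁ := one_le_cast_sub_one (r := r) (by omega)
  have hε₁ := hε.lt_one (r := r) (by omega)
  induction i with
  | zero => simp [hp₁, hp₀.le]
  | succ i ih =>
    obtain ⟨hsurv, hact, hsum⟩ := ih
    have hrate₀ := rate_pos (r := r) (by omega) hp₁ hsurv
    have hrate := rate_le_mul hr hp₀.le hsurv.le (by linarith)
    have hflow₀ : 0 ≤ ε * (rate r p (surv r p ε i) * act r p ε i) :=
      mul_nonneg hε.pos.le (mul_nonneg hrate₀.le hact)
    have hflow : ε * (rate r p (surv r p ε i) * act r p ε i) < surv r p ε i :=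
      calc ε * (rate r p (surv r p ε i) * act r p ε i)
        _ ≤ ε * (((r : ℝ) - 1) * surv r p ε i * 1) := by
          have := hε.pos
          gcongr
          linarith
        _ < surv r p ε i := by nlinarith [hε.mul_lt_one]
    rw [act_succ, surv_succ]
    refine ⟨by linarith, ?_, ?_⟩
    · linarith [mul_nonneg (sub_nonneg.2 hε₁.le) hact]
    · linarith [mul_nonneg hε.pos.le hact]

lemma surv_sub_nonneg (hr : 3 ≤ r) (hp₀ : 0 < p) (hp₁ : p < 1) (hε : IsStepSize r ε) (i : ℕ) :
    0 ≤ surv r p ε i - surv r p ε (i + 1) := by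
  obtain ⟨hsurv, hact, -⟩ := surv_act_bounds hr hp₀ hp₁ hε i
  rw [surv_succ, sub_sub_cancel]
  exact mul_nonneg hε.pos.le (mul_nonneg (rate_pos (by omega) hp₁ hsurv).le hact)

lemma surv_antitone (hr : 3 ≤ r) (hp₀ : 0 < p) (hp₁ : p < 1) (hε : IsStepSize r ε) :
    Antitone (surv r p ε) :=
  antitone_nat_of_succ_le fun i => sub_nonneg.1 (surv_sub_nonneg hr hp₀ hp₁ hε i)

lemma surv_le (hr : 3 ≤ r) (hp₀ : 0 < p) (hp₁ : p < 1) (hε : IsStepSize r ε) (i : ℕ) :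
    surv r p ε i ≤ 1 - p :=
  surv_antitone hr hp₀ hp₁ hε i.zero_le

lemma surv_sub_le (hr : 3 ≤ r) (hp₀ : 0 < p) (hp₁ : p < 1) (hε : IsStepSize r ε) (i : ℕ) :
    surv r p ε i - surv r p ε (i + 1) ≤ ε * ((r : ℝ) - 1) := by
  have hr₁ := one_le_cast_sub_one (r := r) (by omega)
  obtain ⟨hsurv, hact, hsum⟩ := surv_act_bounds hr hp₀ hp₁ hε i
  have hrate := rate_le_mul hr hp₀.le hsurv.le (by linarith)
  rw [surv_succ, sub_sub_cancel]
  refine mul_le_mul_of_nonneg_left ?_ hε.pos.le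
  calc rate r p (surv r p ε i) * act r p ε i
    _ ≤ (((r : ℝ) - 1) * surv r p ε i) * 1 := by gcongr; linarith
    _ ≤ (r : ℝ) - 1 := by nlinarith

lemma activity_le_act_le (hr : 3 ≤ r) (hp₀ : 0 < p) (hp₁ : p < 1) (hε : IsStepSize r ε) (i : ℕ) :
    activity r p (surv r p ε i) ≤ act r p ε i ∧
      act r p ε i ≤ activity r p (surv r p ε i) +
        ε * ((r : ℝ) - 1) * ((rate r p (surv r p ε i))⁻¹ - (rate r p (1 - p))⁻¹) := by
  have hr₂ : 2 ≤ r := by omega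
  induction i with
  | zero => simp [activity_one_sub]
  | succ i ih =>
    have hi := (surv_act_bounds hr hp₀ hp₁ hε i).1
    have hi' := (surv_act_bounds hr hp₀ hp₁ hε (i + 1)).1
    have hle := sub_nonneg.1 (surv_sub_nonneg hr hp₀ hp₁ hε i)
    have hact : act r p ε (i + 1) = act r p ε i -
        (-1 + (rate r p (surv r p ε i))⁻¹) * (surv r p ε i - surv r p ε (i + 1)) := by
      have := (rate_pos hr₂ hp₁ hi).ne'
      rw [act_succ, surv_succ]
      field_simp
      ring
    have hlower := le_activity_sub hr₂ hp₁ hi' hle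
    have hupper := activity_sub_le hr₂ hp₁ hi' hle
    have herror := mul_le_mul_of_nonneg_right (surv_sub_le hr hp₀ hp₁ hε i)
      (sub_nonneg.2 (inv_rate_anti hr₂ hp₁ hi' hle))
    rw [hact]
    constructor <;> linarith [ih.1, ih.2]

lemma IsTerminalFraction.lt_surv (h : IsTerminalFraction r p φ) (hr : 3 ≤ r) (hp₀ : 0 < p)
    (hη : 0 < η) (hηφ : 2 * η < φ) (hε : IsStepSize r ε) (hεη : ε * ((r : ℝ) - 1) ≤ η)
    (herr : ε * ((r : ℝ) - 1) * (rate r p (φ - 2 * η))⁻¹ < -activity r p (φ - η)) (i : ℕ) :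
    φ - η < surv r p ε i := by
  have hp₁ := h.lt_one
  have hr₂ : 2 ≤ r := by omega
  induction i with
  | zero => rw [surv_zero]; linarith [h.lt_init]
  | succ i ih =>
    by_contra! hle
    have hge : φ - 2 * η ≤ surv r p ε (i + 1) := by
      linarith [surv_sub_le hr hp₀ hp₁ hε i]
    have hsurv : 0 < surv r p ε (i + 1) := by linarith
    have hactivity : activity r p (surv r p ε (i + 1)) ≤ activity r p (φ - η) :=
      (h.strictMonoOn_activity hr₂ hp₀).monotoneOn ⟨hsurv, by linarith⟩
        ⟨by linarith, by linarith⟩ hle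
    have hrate : (rate r p (surv r p ε (i + 1)))⁻¹ - (rate r p (1 - p))⁻¹ ≤
        (rate r p (φ - 2 * η))⁻¹ := by
      linarith [inv_rate_anti hr₂ hp₁ (by linarith) hge,
        inv_pos.2 (rate_pos hr₂ hp₁ (sub_pos.2 hp₁))]
    have hstep : 0 ≤ ε * ((r : ℝ) - 1) :=
      mul_nonneg hε.pos.le (by linarith [one_le_cast_sub_one hr₂])
    linarith [mul_le_mul_of_nonneg_left hrate hstep, (activity_le_act_le hr hp₀ hp₁ hε (i + 1)).2,
      (surv_act_bounds hr hp₀ hp₁ hε (i + 1)).2.1]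

lemma IsTerminalFraction.exists_surv_lt (h : IsTerminalFraction r p φ) (hr : 3 ≤ r) (hp₀ : 0 < p)
    (hη : 0 < η) (hε : IsStepSize r ε) : ∃ N, surv r p ε N < φ + η := by
  by_contra! hge
  have hr₂ : 2 ≤ r := by omega
  have hle := surv_le hr hp₀ h.lt_one hε
  obtain ⟨y, hy, hmin⟩ := (isCompact_Icc (a := φ + η) (b := 1 - p)).exists_isMinOn
    ⟨surv r p ε 0, hge 0, hle 0⟩ ((continuousOn_activity hr₂ h.lt_one).mono fun x hx =>
      (add_pos h.pos hη).trans_le hx.1)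
  have hy₀ : 0 < activity r p y := h.activity_pos hr₂ hp₀ ⟨by linarith [hy.1], hy.2⟩
  have hrate := rate_pos hr₂ h.lt_one h.pos
  set κ := ε * (rate r p φ * activity r p y)
  have hκ : 0 < κ := mul_pos hε.pos (mul_pos hrate hy₀)
  have hstep : ∀ i, surv r p ε (i + 1) ≤ surv r p ε i - κ := fun i => by
    have hact : activity r p y ≤ act r p ε i :=
      (isMinOn_iff.1 hmin _ ⟨hge i, hle i⟩).trans (activity_le_act_le hr hp₀ h.lt_one hε i).1
    have hrate_le : rate r p φ ≤ rate r p (surv r p ε i) :=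
      rate_mono hr₂ h.lt_one h.pos.le (by linarith [hge i])
    rw [surv_succ]
    exact sub_le_sub_left (mul_le_mul_of_nonneg_left
      (mul_le_mul hrate_le hact hy₀.le (hrate.le.trans hrate_le)) hε.pos.le) _
  have hlin : ∀ i : ℕ, surv r p ε i ≤ 1 - p - i * κ := fun i => by
    induction i with
    | zero => simp
    | succ i ih => push_cast; linarith [hstep i]
  obtain ⟨i, hi⟩ := exists_nat_gt (1 / κ)
  rw [div_lt_iff₀ hκ] at hi
  linarith [hlin i, hge i, h.pos]

lemma IsTerminalFraction.exists_isStepSize_surv_near (h : IsTerminalFraction r p φ) (hr : 3 ≤ r)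
    (hp₀ : 0 < p) (hη : 0 < η) :
    ∃ ε, IsStepSize r ε ∧ ε < η ∧ ∃ N, |surv r p ε N - φ| < η := by
  wlog hηφ : 2 * η < φ generalizing η
  · have hφ := h.pos
    obtain ⟨ε, hε, hεη, N, hN⟩ := this (η := min η (φ / 3)) (by positivity)
      (by linarith [min_le_right η (φ / 3)])
    exact ⟨ε, hε, hεη.trans_le (min_le_left _ _), N, hN.trans_le (min_le_left _ _)⟩
  have hr₁ := one_le_cast_sub_one (r := r) (by omega)
  have hneg : 0 < -activity r p (φ - η) := by
    have := h.strictMonoOn_activity (by omega) hp₀ (a := φ - η) ⟨by linarith, by linarith⟩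
      ⟨h.pos, le_rfl⟩ (by linarith)
    linarith [h.activity_eq_zero]
  have hrate : 0 < rate r p (φ - 2 * η) := rate_pos (by omega) h.lt_one (by linarith)
  obtain ⟨m, hm₀, hm⟩ := exists_between (show
    0 < min 1 (min η (-activity r p (φ - η) * rate r p (φ - 2 * η))) by positivity)
  simp only [lt_min_iff] at hm
  have hmul : m / ((r : ℝ) - 1) * ((r : ℝ) - 1) = m := div_mul_cancel₀ _ (by linarith)
  have hε : IsStepSize r (m / ((r : ℝ) - 1)) := ⟨by positivity, by rw [hmul]; exact hm.1⟩
  obtain ⟨N, hN⟩ := h.exists_surv_lt hr hp₀ hη hε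
  have hlt := h.lt_surv hr hp₀ hη hηφ hε (by rw [hmul]; exact hm.2.1.le)
    (by rw [hmul, ← div_eq_mul_inv, div_lt_iff₀ hrate]; exact hm.2.2) N
  exact ⟨_, hε, (div_le_self hm₀.le hr₁).trans_lt hm.2.1, N, abs_lt.2 ⟨by linarith, by linarith⟩⟩

lemma le_sum_step (hr : 2 ≤ r) (N : ℕ) :
    (r : ℝ) / (2 * ((r : ℝ) - 1)) * ((1 - p) ^ 2 - surv r p ε N ^ 2) ≤
      ∑ i ∈ Finset.range N, ε * ((1 - p) * r * act r p ε i * surv r p ε i ^ (r - 1)) := by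
  have hr₁ := one_le_cast_sub_one hr
  induction N with
  | zero => simp
  | succ N ih =>
    have hterm : ε * ((1 - p) * r * act r p ε N * surv r p ε N ^ (r - 1)) =
        (r : ℝ) / (2 * ((r : ℝ) - 1)) *
          (2 * surv r p ε N * (surv r p ε N - surv r p ε (N + 1))) := by
      have : (r : ℝ) - 1 ≠ 0 := by linarith
      rw [surv_succ, sub_sub_cancel, rate, show r - 1 = (r - 2) + 1 by omega, pow_succ]
      field_simp
    have hsq : surv r p ε N ^ 2 - surv r p ε (N + 1) ^ 2 ≤
        2 * surv r p ε N * (surv r p ε N - surv r p ε (N + 1)) := by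
      nlinarith [sq_nonneg (surv r p ε N - surv r p ε (N + 1))]
    have hcoef : 0 ≤ (r : ℝ) / (2 * ((r : ℝ) - 1)) := div_nonneg r.cast_nonneg (by linarith)
    rw [Finset.sum_range_succ, hterm]
    linarith [mul_le_mul_of_nonneg_left hsq hcoef]

lemma xiVal_surv_sub_le_density (hr : 3 ≤ r) (hp₀ : 0 < p) (hp₁ : p < 1) (hε : IsStepSize r ε) :
    xiVal r p (surv r p ε N) - r * ε - r * rate r p (surv r p ε N) ^ k ≤ density r p ε N k := by
  have hr₁ := one_le_cast_sub_one (r := r) (by omega)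
  have hε₁ := hε.lt_one (r := r) (by omega)
  have hsurv₀ := (surv_act_bounds hr hp₀ hp₁ hε N).1
  have hsurv := surv_le hr hp₀ hp₁ hε N
  set G := (r : ℝ) / (2 * ((r : ℝ) - 1)) * ((1 - p) ^ 2 - surv r p ε N ^ 2) with hG
  have hdiff : (1 - p) ^ 2 - surv r p ε N ^ 2 ∈ Icc 0 1 := ⟨by nlinarith, by nlinarith⟩
  have hG₀ : 0 ≤ G := mul_nonneg (div_nonneg r.cast_nonneg (by linarith)) hdiff.1
  have hG₁ : G ≤ 1 :=
    mul_le_one₀ (by rw [div_le_one (by linarith)]; linarith) hdiff.1 hdiff.2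
  have hbernoulli : 1 - r * ε ≤ (1 - ε) ^ r := by
    have := one_add_mul_le_pow (show -2 ≤ -ε by linarith) r
    rwa [mul_neg, ← sub_eq_add_neg, ← sub_eq_add_neg] at this
  have hsum := mul_le_mul_of_nonneg_left (le_sum_step (r := r) (p := p) (ε := ε) (by omega) N)
    (pow_nonneg (sub_nonneg.2 hε₁.le) r)
  have hloss : G - r * ε ≤ (1 - ε) ^ r * G := by
    nlinarith [mul_nonneg r.cast_nonneg hε.pos.le]
  rw [xiVal, ← hG, density]
  linarith

lemma IsTerminalFraction.exists_density_ge (h : IsTerminalFraction r p φ) (hr : 3 ≤ r)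
    (hp₀ : 0 < p) (hδ : 0 < δ) :
    ∃ ε, IsStepSize r ε ∧ ∃ N k, xiVal r p φ - δ ≤ density r p ε N k := by
  have hr₀ : (0 : ℝ) < r := by exact_mod_cast (by omega : 0 < r)
  obtain ⟨ρ, hρ, hρ₁⟩ := exists_between (h.rate_lt_one (by omega) hp₀)
  obtain ⟨k, hk⟩ := exists_pow_lt_of_lt_one (show 0 < δ / (3 * r) by positivity) hρ₁
  have hnear : ∀ᶠ f in 𝓝 φ, rate r p f < ρ ∧ xiVal r p φ - δ / 3 < xiVal r p f := by
    have hcont : Continuous (xiVal r p) := by unfold xiVal; fun_prop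
    exact (continuous_rate.continuousAt.eventually_lt continuousAt_const hρ).and
      (continuousAt_const.eventually_lt hcont.continuousAt (by linarith))
  obtain ⟨η, hη, hball⟩ := Metric.eventually_nhds_iff.1 hnear
  obtain ⟨ε, hε, hεη, N, hN⟩ := h.exists_isStepSize_surv_near hr hp₀
    (lt_min hη (show 0 < δ / (3 * r) by positivity))
  obtain ⟨hrate, hxi⟩ := hball (hN.trans_le (min_le_left _ _))
  have hpow : rate r p (surv r p ε N) ^ k ≤ δ / (3 * r) :=
    (pow_le_pow_left₀ (rate_pos (by omega) h.lt_one
      (surv_act_bounds hr hp₀ h.lt_one hε N).1).le hrate.le k).trans hk.le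
  have hthird : (r : ℝ) * (δ / (3 * r)) = δ / 3 := by field_simp
  have hstep := mul_le_mul_of_nonneg_left (hεη.le.trans (min_le_right _ _)) hr₀.le
  have htail := mul_le_mul_of_nonneg_left hpow hr₀.le
  refine ⟨ε, hε, N, k, le_trans ?_ (xiVal_surv_sub_le_density hr hp₀ h.lt_one hε)⟩
  linarith

end Discretisation

section Indicator

variable {α : Type*} {P Q : Prop} {s : Finset α} {R : α → Prop}

open Classical in
/-- The indicator of a proposition. -/
def ind (P : Prop) : ℝ := if P then 1 else 0

lemma ind_of_true (h : P) : ind P = 1 := if_pos h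

lemma ind_of_false (h : ¬P) : ind P = 0 := if_neg h

lemma ind_nonneg : 0 ≤ ind P := by unfold ind; split_ifs <;> norm_num

lemma ind_and : ind (P ∧ Q) = ind P * ind Q := by
  by_cases hP : P <;> by_cases hQ : Q <;> simp [ind, hP, hQ]

lemma ind_not : ind (¬P) = 1 - ind P := by by_cases hP : P <;> simp [ind, hP]

lemma ind_or (h : P → ¬Q) : ind (P ∨ Q) = ind P + ind Q := by
  by_cases hP : P
  · simp [ind, hP, h hP]
  · by_cases hQ : Q <;> simp [ind, hP, hQ]

lemma ind_and_not (h : Q → P) : ind (P ∧ ¬Q) = ind (¬Q) - ind (¬P) := by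
  by_cases hQ : Q
  · simp [ind, hQ, h hQ]
  · by_cases hP : P <;> simp [ind, hP, hQ]

lemma ind_forall (s : Finset α) (R : α → Prop) :
    ind (∀ a ∈ s, R a) = ∏ a ∈ s, ind (R a) := by
  classical
  induction s using Finset.induction_on with
  | empty => simp [ind]
  | insert a s ha ih => rw [Finset.prod_insert ha, ← ih, ← ind_and]; simp

lemma ind_exists_le (s : Finset α) (R : α → Prop) :
    ind (∃ a ∈ s, R a) ≤ ∑ a ∈ s, ind (R a) := by
  by_cases h : ∃ a ∈ s, R a
  · obtain ⟨a, ha, hRa⟩ := h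
    rw [ind_of_true ⟨a, ha, hRa⟩, ← ind_of_true hRa]
    exact Finset.single_le_sum (f := fun a => ind (R a)) (fun _ _ => ind_nonneg) ha
  · rw [ind_of_false h]
    exact Finset.sum_nonneg fun _ _ => ind_nonneg

lemma ind_exists (hR : ∀ a ∈ s, ∀ b ∈ s, R a → R b → a = b) :
    ind (∃ a ∈ s, R a) = ∑ a ∈ s, ind (R a) := by
  by_cases h : ∃ a ∈ s, R a
  · obtain ⟨a, ha, hRa⟩ := h
    rw [ind_of_true ⟨a, ha, hRa⟩, Finset.sum_eq_single a _ (absurd ha), ind_of_true hRa]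
    exact fun b hb hba => ind_of_false fun hRb => hba (hR b hb a ha hRb hRa)
  · rw [ind_of_false h, Finset.sum_eq_zero]
    exact fun a ha => ind_of_false fun hRa => h ⟨a, ha, hRa⟩

end Indicator

section Dependence

variable {K A ι : Type*} {P Q : (K → A) → Prop} {S : Set K} {s : Finset ι}
  {R : ι → (K → A) → Prop}

lemma dependsOn_ind (hP : DependsOn P S) : DependsOn (fun ω => ind (P ω)) S :=
  fun _ _ hxy => congrArg ind (hP hxy)

lemma dependsOn_not (hP : DependsOn P S) : DependsOn (fun ω => ¬P ω) S :=
  fun _ _ hxy => congrArg Not (hP hxy)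

lemma dependsOn_and (hP : DependsOn P S) (hQ : DependsOn Q S) :
    DependsOn (fun ω => P ω ∧ Q ω) S := fun _ _ hxy => congrArg₂ And (hP hxy) (hQ hxy)

lemma dependsOn_or (hP : DependsOn P S) (hQ : DependsOn Q S) :
    DependsOn (fun ω => P ω ∨ Q ω) S := fun _ _ hxy => congrArg₂ Or (hP hxy) (hQ hxy)

lemma dependsOn_forall (hR : ∀ i ∈ s, DependsOn (R i) S) :
    DependsOn (fun ω => ∀ i ∈ s, R i ω) S := fun _ _ hxy =>
  propext (forall₂_congr fun i hi => (hR i hi hxy).to_iff)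

lemma dependsOn_exists (hR : ∀ i ∈ s, DependsOn (R i) S) :
    DependsOn (fun ω => ∃ i ∈ s, R i ω) S := fun _ _ hxy =>
  propext (exists_congr fun i => and_congr_right fun hi => (hR i hi hxy).to_iff)

lemma dependsOn_existsUnique (hR : ∀ i ∈ s, DependsOn (R i) S) :
    DependsOn (fun ω => ∃! i, i ∈ s ∧ R i ω) S := fun _ _ hxy =>
  propext (existsUnique_congr fun i => and_congr_right fun hi => (hR i hi hxy).to_iff)

lemma dependsOn_finset_prod {F : ι → (K → A) → ℝ} {S : ι → Set K}
    (hF : ∀ i ∈ s, DependsOn (F i) (S i)) :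
    DependsOn (fun ω => ∏ i ∈ s, F i ω) (⋃ i ∈ s, S i) := fun _ _ hxy =>
  Finset.prod_congr rfl fun i hi => hF i hi fun k hk => hxy k (mem_biUnion hi hk)

end Dependence

section Expectation

variable {K A : Type*} [Fintype K] [Fintype A] [DecidableEq K] {m : K → A → ℝ}

/-- The expectation of `F` under the product of the weights `m k` on the coordinates `k`. -/
def expect (m : K → A → ℝ) (F : (K → A) → ℝ) : ℝ := ∑ ω, (∏ k, m k (ω k)) * F ω

lemma expect_add (F F' : (K → A) → ℝ) :
    expect m (fun ω => F ω + F' ω) = expect m F + expect m F' := by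
  simp [expect, mul_add, Finset.sum_add_distrib]

lemma expect_sub (F F' : (K → A) → ℝ) :
    expect m (fun ω => F ω - F' ω) = expect m F - expect m F' := by
  simp [expect, mul_sub, Finset.sum_sub_distrib]

lemma expect_sum {ι : Type*} (s : Finset ι) (F : ι → (K → A) → ℝ) :
    expect m (fun ω => ∑ i ∈ s, F i ω) = ∑ i ∈ s, expect m (F i) := by
  simp only [expect, Finset.mul_sum]
  rw [Finset.sum_comm]

lemma expect_mul_const (F : (K → A) → ℝ) (c : ℝ) :
    expect m (fun ω => F ω * c) = expect m F * c := by
  simp only [expect, Finset.sum_mul, mul_assoc]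

lemma expect_mono (hm : ∀ k a, 0 ≤ m k a) {F F' : (K → A) → ℝ} (h : ∀ ω, F ω ≤ F' ω) :
    expect m F ≤ expect m F' :=
  Finset.sum_le_sum fun ω _ =>
    mul_le_mul_of_nonneg_left (h ω) (Finset.prod_nonneg fun k _ => hm k _)

lemma expect_prod_coord (g : K → A → ℝ) :
    expect m (fun ω => ∏ k, g k (ω k)) = ∏ k, ∑ a, m k a * g k a := by
  simp only [expect, Finset.prod_univ_sum, ← Finset.prod_mul_distrib, Fintype.piFinset_univ]

lemma expect_const (h₁ : ∀ k, ∑ a, m k a = 1) (c : ℝ) : expect m (fun _ => c) = c := by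
  have hone := expect_prod_coord (m := m) fun _ _ => 1
  simp only [Finset.prod_const_one, mul_one, h₁] at hone
  simpa [hone] using expect_mul_const (m := m) (fun _ => 1) c

lemma expect_coord (h₁ : ∀ k, ∑ a, m k a = 1) (k : K) (g : A → ℝ) :
    expect m (fun ω => g (ω k)) = ∑ a, m k a * g a := by
  have hprod := expect_prod_coord (m := m) fun j a => if j = k then g a else 1
  simp only [Finset.prod_ite_eq', Finset.mem_univ, if_true] at hprod
  rw [hprod, Finset.prod_eq_single k _ (absurd (Finset.mem_univ k))]
  · simp
  · intro j _ hj
    simp [hj, h₁]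

/-- The expectation over the coordinates in `S`, those outside `S` being frozen at `ω₀`. -/
def expectOn (m : K → A → ℝ) (S : Set K) (ω₀ : K → A) (F : (K → A) → ℝ) : ℝ :=
  open Classical in
  ∑ x : S → A, (∏ k : S, m k (x k)) * F fun k => if hk : k ∈ S then x ⟨k, hk⟩ else ω₀ k

lemma expect_mul_eq_expectOn (ω₀ : K → A) {F F' : (K → A) → ℝ} {S : Set K}
    (hF : DependsOn F S) (hF' : DependsOn F' Sᶜ) :
    expect m (fun ω => F ω * F' ω) = expectOn m S ω₀ F * expectOn m Sᶜ ω₀ F' := by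
  classical
  let e := Equiv.piEquivPiSubtypeProd (fun k => k ∈ S) (fun _ : K => A)
  have hweight (x) : ∏ k, m k (e.symm x k) = (∏ k : S, m k (x.1 k)) *
      ∏ k : (Sᶜ : Set K), m k (x.2 k) := by
    rw [← Fintype.prod_subtype_mul_prod_subtype (fun k => k ∈ S)]
    congr 1 <;> refine Finset.prod_congr rfl fun k _ => ?_
    · simp [e, k.2]
    · have hk : (k : K) ∉ S := k.2
      simp [e, hk]
  rw [expect, ← e.symm.sum_comp, expectOn, expectOn, Finset.sum_mul_sum, Fintype.sum_prod_type]
  refine Finset.sum_congr rfl fun x _ => Finset.sum_congr (by congr!) fun y _ => ?_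
  have hx : F (e.symm (x, y)) = F fun k => if hk : k ∈ S then x ⟨k, hk⟩ else ω₀ k :=
    hF fun k hk => by simp [e, hk]
  have hy : F' (e.symm (x, y)) = F' fun k => if hk : k ∈ Sᶜ then y ⟨k, hk⟩ else ω₀ k :=
    hF' fun k hk => by
      have hkS : k ∉ S := hk
      simp [e, hkS]
  rw [hweight, hx, hy, mul_mul_mul_comm]
  congr!

lemma expect_mul (h₁ : ∀ k, ∑ a, m k a = 1) {F F' : (K → A) → ℝ} {S T : Set K}
    (hF : DependsOn F S) (hF' : DependsOn F' T) (hST : Disjoint S T) :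
    expect m (fun ω => F ω * F' ω) = expect m F * expect m F' := by
  rcases isEmpty_or_nonempty (K → A) with _ | ⟨⟨ω₀⟩⟩
  · simp [expect]
  have hF'c : DependsOn F' Sᶜ := hF'.mono (subset_compl_iff_disjoint_left.2 hST)
  have hone (U : Set K) : DependsOn (fun _ : K → A => (1 : ℝ)) U :=
    (dependsOn_const _).mono (empty_subset _)
  have hFF' := expect_mul_eq_expectOn (m := m) ω₀ hF hF'c
  have hF₁ := expect_mul_eq_expectOn (m := m) ω₀ hF (hone _)
  have hF'₁ := expect_mul_eq_expectOn (m := m) ω₀ (hone _) hF'c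
  have h₁₁ := expect_mul_eq_expectOn (m := m) ω₀ (hone S) (hone _)
  simp only [mul_one, one_mul, expect_const h₁] at hF₁ hF'₁ h₁₁
  rw [hFF', hF₁, hF'₁]
  linear_combination expectOn m S ω₀ F * expectOn m Sᶜ ω₀ F' * h₁₁

lemma expect_finset_prod (h₁ : ∀ k, ∑ a, m k a = 1) {ι : Type*} (s : Finset ι)
    {F : ι → (K → A) → ℝ} {S : ι → Set K} (hF : ∀ i ∈ s, DependsOn (F i) (S i))
    (hS : (s : Set ι).PairwiseDisjoint S) :
    expect m (fun ω => ∏ i ∈ s, F i ω) = ∏ i ∈ s, expect m (F i) := by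
  classical
  induction s using Finset.induction_on with
  | empty => simpa using expect_const h₁ 1
  | insert a s ha ih =>
    rw [Finset.coe_insert, pairwiseDisjoint_insert_of_notMem (by simpa using ha)] at hS
    have hFs := fun i hi => hF i (Finset.mem_insert_of_mem hi)
    simp only [Finset.prod_insert ha]
    rw [← ih hFs hS.1]
    refine expect_mul h₁ (hF a (Finset.mem_insert_self _ _)) (dependsOn_finset_prod hFs) ?_
    exact disjoint_iUnion₂_right.2 hS.2

lemma exists_expect_le (h₀ : ∀ k a, 0 ≤ m k a) (h₁ : ∀ k, ∑ a, m k a = 1) (F : (K → A) → ℝ) :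
    ∃ ω, expect m F ≤ F ω := by
  have hsum : ∑ ω : K → A, ∏ k, m k (ω k) = 1 := by simpa [expect] using expect_const h₁ 1
  have hprod (ω : K → A) : 0 ≤ ∏ k, m k (ω k) := Finset.prod_nonneg fun k _ => h₀ k _
  by_contra! h
  obtain ⟨ω, -, hω⟩ := Finset.exists_ne_zero_of_sum_ne_zero (hsum.trans_ne one_ne_zero)
  have hlt : expect m F < expect m fun _ => expect m F :=
    Finset.sum_lt_sum (fun ω _ => mul_le_mul_of_nonneg_left (h ω).le (hprod ω))
      ⟨ω, Finset.mem_univ _, mul_lt_mul_of_pos_left (h ω) ((hprod ω).lt_of_ne' hω)⟩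
  exact (hlt.trans_eq (expect_const h₁ _)).false

/-- The probability of the event `P` under the product of the weights `m k`. -/
def prob (m : K → A → ℝ) (P : (K → A) → Prop) : ℝ := expect m fun ω => ind (P ω)

lemma prob_not (h₁ : ∀ k, ∑ a, m k a = 1) (P : (K → A) → Prop) :
    prob m (fun ω => ¬P ω) = 1 - prob m P := by
  simp only [prob, ind_not, expect_sub, expect_const h₁]

lemma prob_and (h₁ : ∀ k, ∑ a, m k a = 1) {P Q : (K → A) → Prop} {S T : Set K}
    (hP : DependsOn P S) (hQ : DependsOn Q T) (hST : Disjoint S T) :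
    prob m (fun ω => P ω ∧ Q ω) = prob m P * prob m Q := by
  simp only [prob, ind_and]
  exact expect_mul h₁ (dependsOn_ind hP) (dependsOn_ind hQ) hST

lemma prob_or {P Q : (K → A) → Prop} (h : ∀ ω, P ω → ¬Q ω) :
    prob m (fun ω => P ω ∨ Q ω) = prob m P + prob m Q := by
  simp only [prob, ind_or (h _), expect_add]

lemma prob_and_not {P Q : (K → A) → Prop} (h : ∀ ω, Q ω → P ω) :
    prob m (fun ω => P ω ∧ ¬Q ω) = prob m (fun ω => ¬Q ω) - prob m (fun ω => ¬P ω) := by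
  simp only [prob, ind_and_not (h _), expect_sub]

lemma prob_forall (h₁ : ∀ k, ∑ a, m k a = 1) {ι : Type*} (s : Finset ι)
    {P : ι → (K → A) → Prop} {S : ι → Set K} (hP : ∀ i ∈ s, DependsOn (P i) (S i))
    (hS : (s : Set ι).PairwiseDisjoint S) :
    prob m (fun ω => ∀ i ∈ s, P i ω) = ∏ i ∈ s, prob m (P i) := by
  simp only [prob, ind_forall]
  exact expect_finset_prod h₁ s (fun i hi => dependsOn_ind (hP i hi)) hS

lemma prob_exists_le (h₀ : ∀ k a, 0 ≤ m k a) {ι : Type*} (s : Finset ι)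
    (P : ι → (K → A) → Prop) :
    prob m (fun ω => ∃ i ∈ s, P i ω) ≤ ∑ i ∈ s, prob m (P i) :=
  (expect_mono h₀ fun _ => ind_exists_le s _).trans_eq (expect_sum s _)

lemma prob_exists {ι : Type*} {s : Finset ι} {P : ι → (K → A) → Prop}
    (hP : ∀ ω, ∀ i ∈ s, ∀ j ∈ s, P i ω → P j ω → i = j) :
    prob m (fun ω => ∃ i ∈ s, P i ω) = ∑ i ∈ s, prob m (P i) := by
  simp only [prob, ind_exists (hP _), expect_sum]

end Expectation

section Graph

open SimpleGraph

variable {V : Type*} {G : SimpleGraph V} {g i j : ℕ} {u v w x : V}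

lemma isPath_eq_of_length_lt_egirth (hg : (g : ℕ∞) ≤ G.egirth) {p q : G.Walk u v}
    (hp : p.IsPath) (hq : q.IsPath) (hlen : p.length + q.length < g) : p = q := by
  classical
  let H : SimpleGraph V := fromEdgeSet {e | e ∈ p.edges ++ q.edges}
  have hsub : {e | e ∈ p.edges ++ q.edges} ⊆ G.edgeSet := fun e he =>
    (List.mem_append.1 he).elim (p.edges_subset_edgeSet ·) (q.edges_subset_edgeSet ·)
  have hHset : H.edgeSet = {e | e ∈ p.edges ++ q.edges} :=
    (edgeSet_fromEdgeSet _).trans (sdiff_eq_left.2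
      (disjoint_left.2 fun e he hdiag => G.not_isDiag_of_mem_edgeSet (hsub he) hdiag))
  have hHG : H ≤ G := edgeSet_subset_edgeSet.1 (hHset.trans_subset hsub)
  have hH : H.IsAcyclic := by
    intro a c hc
    have hgc : g ≤ c.length :=
      Nat.cast_le.1 ((hg.trans (egirth_anti hHG)).trans (egirth_le_length hc))
    have hc_le : c.edges.length ≤ (p.edges ++ q.edges).length :=
      (hc.edges_nodup.subperm fun e he => by
        have heH := c.edges_subset_edgeSet he
        rwa [hHset] at heH).length_le
    simp only [List.length_append, Walk.length_edges] at hc_le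
    omega
  have hp' : ∀ e ∈ p.edges, e ∈ H.edgeSet := fun e he => by
    rw [hHset]; exact List.mem_append_left _ he
  have hq' : ∀ e ∈ q.edges, e ∈ H.edgeSet := fun e he => by
    rw [hHset]; exact List.mem_append_right _ he
  have htransfer : p.transfer H hp' = q.transfer H hq' := congrArg Subtype.val
    ((hH.subsingleton_path u v).elim ⟨_, hp.transfer hp'⟩ ⟨_, hq.transfer hq'⟩)
  refine Walk.ext_support ?_
  simpa only [Walk.support_transfer] using congrArg Walk.support htransfer

variable (G) in
/-- The vertices reached from `v` by non-backtracking walks of length at most `j` that do not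
start towards `u`. In a tree and for adjacent `u` and `v`, this is the part within distance `j` of
`v` of the branch at `v` seen from `u`. -/
def branchBall : ℕ → V → V → Set V
  | 0, v, _ => {v}
  | j + 1, v, u => {v} ∪ {x | ∃ w, G.Adj v w ∧ w ≠ u ∧ x ∈ branchBall j w v}

lemma self_mem_branchBall (j : ℕ) (v u : V) : v ∈ branchBall G j v u := by
  cases j <;> simp [branchBall]

lemma branchBall_subset_succ (hw : G.Adj v w) (hwu : w ≠ u) :
    branchBall G j w v ⊆ branchBall G (j + 1) v u :=
  fun _ hx => Or.inr ⟨w, hw, hwu, hx⟩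

lemma branchBall_mono (hij : i ≤ j) (v u : V) : branchBall G i v u ⊆ branchBall G j v u := by
  induction i generalizing j v u with
  | zero => rintro x rfl; exact self_mem_branchBall _ _ _
  | succ i ih =>
    obtain ⟨j, rfl⟩ := Nat.exists_eq_succ_of_ne_zero (by omega : j ≠ 0)
    rintro x (rfl | ⟨w, hw, hwu, hx⟩)
    · exact self_mem_branchBall _ _ _
    · exact branchBall_subset_succ hw hwu (ih (by omega) w v hx)

/-- A graph is tree-like to depth `j` if the branches of depth `j` hanging from a common vertex
avoid that vertex and are pairwise disjoint. -/
structure TreeLike (G : SimpleGraph V) (j : ℕ) : Prop where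
  notMem : ∀ v w, G.Adj v w → v ∉ branchBall G j w v
  disjoint : ∀ v w w', G.Adj v w → G.Adj v w' → w ≠ w' →
    Disjoint (branchBall G j w v) (branchBall G j w' v)

lemma TreeLike.mono (h : TreeLike G j) (hij : i ≤ j) : TreeLike G i where
  notMem v w hw hv := h.notMem v w hw (branchBall_mono hij _ _ hv)
  disjoint v w w' hw hw' hne :=
    (h.disjoint v w w' hw hw' hne).mono (branchBall_mono hij _ _) (branchBall_mono hij _ _)

lemma exists_isPath_of_mem_branchBall (hg : (g : ℕ∞) ≤ G.egirth) (hj : j + 2 < g)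
    (hvw : G.Adj v w) (hx : x ∈ branchBall G j w v) :
    ∃ p : G.Walk w x, (p.cons hvw).IsPath ∧ p.length ≤ j := by
  classical
  induction j generalizing v w with
  | zero =>
    obtain rfl : x = w := hx
    exact ⟨.nil, by simp [hvw.ne], le_rfl⟩
  | succ j ih =>
    rcases hx with rfl | ⟨w', hw', hne, hx⟩
    · exact ⟨.nil, by simp [hvw.ne], Nat.zero_le _⟩
    · obtain ⟨p, hp, hlen⟩ := ih (by omega) hw' hx
      refine ⟨p.cons hw', hp.cons fun hv => ?_, by simpa using hlen⟩
      -- Otherwise the path returns to `v` by a route other than the edge `w v`.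
      have hedge : (Walk.cons hvw.symm .nil : G.Walk w v).IsPath := by simp [hvw.ne']
      have hlen_le := (p.cons hw').length_takeUntil_le_length hv
      have heq := isPath_eq_of_length_lt_egirth hg (hp.takeUntil hv) hedge (by
        simp only [Walk.length_cons, Walk.length_nil] at hlen_le ⊢
        omega)
      have hsnd := congrArg Walk.snd heq
      rw [Walk.snd_takeUntil hvw.ne] at hsnd
      exact hne (by simpa using hsnd)

lemma treeLike_of_le_egirth (hg : (g : ℕ∞) ≤ G.egirth) (hj : 2 * j + 2 < g) : TreeLike G j where
  notMem v w hw hv := by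
    obtain ⟨p, hp, -⟩ := exists_isPath_of_mem_branchBall hg (by omega) hw hv
    exact (Walk.cons_isPath_iff _ _).1 hp |>.2 p.end_mem_support
  disjoint v w w' hw hw' hne := disjoint_left.2 fun x hx hx' => by
    obtain ⟨p, hp, hlen⟩ := exists_isPath_of_mem_branchBall hg (by omega) hw hx
    obtain ⟨q, hq, hlen'⟩ := exists_isPath_of_mem_branchBall hg (by omega) hw' hx'
    have heq := isPath_eq_of_length_lt_egirth hg hp hq (by
      simp only [Walk.length_cons]
      omega)
    exact hne (by simpa using congrArg Walk.snd heq)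

/-- A set of vertices inducing a subgraph of minimum degree at least two, such as a cycle. -/
def IsTwoCore (G : SimpleGraph V) (T : Set V) : Prop :=
  ∀ v ∈ T, ∃ a ∈ T, ∃ b ∈ T, a ≠ b ∧ G.Adj v a ∧ G.Adj v b

lemma isAcyclic_induce_of_forall_not_isTwoCore {S : Set V}
    (h : ∀ T ⊆ S, T.Finite → T.Nonempty → ¬IsTwoCore G T) : (G.induce S).IsAcyclic := by
  intro u c hc
  refine h (Subtype.val '' {x | x ∈ c.support}) (by rintro _ ⟨x, -, rfl⟩; exact x.2)
    ((List.finite_toSet c.support).image _) ⟨u, u, c.start_mem_support, rfl⟩ ?_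
  rintro _ ⟨x, hx, rfl⟩
  obtain ⟨a, b, hab, hset⟩ := ncard_eq_two.1 (hc.ncard_neighborSet_toSubgraph_eq_two hx)
  have hnbr (y) (hy : y ∈ c.toSubgraph.neighborSet x) : y ∈ c.support ∧ (G.induce S).Adj x y :=
    ⟨c.mem_verts_toSubgraph.1 (c.toSubgraph.edge_vert hy.symm), c.toSubgraph.adj_sub hy⟩
  obtain ⟨ha, hxa⟩ := hnbr a (by simp [hset])
  obtain ⟨hb, hxb⟩ := hnbr b (by simp [hset])
  exact ⟨a, ⟨a, ha, rfl⟩, b, ⟨b, hb, rfl⟩, Subtype.coe_ne_coe.2 hab, hxa, hxb⟩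

lemma card_le_tau [Fintype V] {S : Finset V} (hS : (G.induce (S : Set V)).IsAcyclic) :
    S.card ≤ tau G :=
  le_csSup ⟨Fintype.card V, by rintro _ ⟨T, -, rfl⟩; exact T.card_le_univ⟩ ⟨S, hS, rfl⟩

end Graph

/-- The randomness of the exploration process: for each vertex a sequence of activation coins and,
for each of its at most `r` missing neighbours, the time at which this neighbour is explored. -/
structure Seed (V : Type*) (r : ℕ) where
  coin : V → ℕ → Prop
  delay : V → Fin r → ℕ

section Exploration

variable {V : Type*} [Fintype V] [DecidableEq V] {G : SimpleGraph V} [DecidableRel G.Adj]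
  {r N i j k : ℕ} {σ : Seed V r} {u v w x : V} {a b : V ⊕ Fin r} {T : Set V}

variable (G r) in
/-- The neighbours of `v` other than `u`, where a vertex of degree less than `r` is given missing
neighbours so that it has `r` neighbours in total. -/
def slots (v u : V) : Finset (V ⊕ Fin r) :=
  ((G.neighborFinset v).erase u).disjSum {s : Fin r | (s : ℕ) < r - G.degree v}

lemma inl_mem_slots : Sum.inl w ∈ slots G r v u ↔ w ≠ u ∧ G.Adj v w := by simp [slots]

lemma slots_subset (v u : V) : slots G r v u ⊆ slots G r v v := by
  rintro (w | s) h
  · rw [inl_mem_slots] at h ⊢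
    exact ⟨h.2.ne', h.2⟩
  · simpa [slots] using h

lemma card_slots : (slots G r v u).card =
    ((G.neighborFinset v).erase u).card + (r - G.degree v) := by
  rw [slots, Finset.card_disjSum, Fin.card_filter_val_lt, min_eq_right (Nat.sub_le _ _)]

lemma card_slots_of_adj (hdeg : G.degree v ≤ r) (h : G.Adj v u) :
    (slots G r v u).card = r - 1 := by
  have hpos : 0 < G.degree v := (G.degree_pos_iff_exists_adj v).2 ⟨u, h⟩
  rw [card_slots, Finset.card_erase_of_mem (by simpa using h), G.card_neighborFinset_eq_degree]
  omega

lemma card_slots_self (hdeg : G.degree v ≤ r) : (slots G r v v).card = r := by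
  rw [card_slots, Finset.erase_eq_of_notMem (by simp), G.card_neighborFinset_eq_degree]
  omega

variable (G σ) in
/-- `v` is explored by time `i` if its neighbour `u` is ignored: `v` is explored at time `0`
according to its coin, and at time `i + 1` if exactly one of its neighbours is explored by time `i`
and its coin says so. -/
def Explored : ℕ → V → V → Prop
  | 0, v, _ => σ.coin v 0
  | i + 1, v, u => Explored i v u ∨ (σ.coin v (i + 1) ∧ ∃! a, a ∈ slots G r v u ∧
      Sum.elim (fun w => Explored i w v) (fun s => σ.delay v s ≤ i) a)

variable (G σ) in
/-- The neighbour `a` of `v`, real or missing, is explored by time `i` if `v` is ignored. -/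
def Arrived (i : ℕ) (v : V) (a : V ⊕ Fin r) : Prop :=
  Sum.elim (fun w => Explored G σ i w v) (fun s => σ.delay v s ≤ i) a

variable (G σ) in
/-- The neighbour `a` of `v` is explored by time `i`, and the coin of `v` has not come up since. -/
def Live : ℕ → V → V ⊕ Fin r → Prop
  | 0, v, a => Arrived G σ 0 v a
  | i + 1, v, a =>
    (Live i v a ∧ ¬σ.coin v (i + 1)) ∨ (Arrived G σ (i + 1) v a ∧ ¬Arrived G σ i v a)

variable (G σ) in
/-- At time `i` the vertex `v` is unexplored and, among its neighbours other than `u`, exactly `a`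
is explored. -/
def Blue (i : ℕ) (v u : V) (a : V ⊕ Fin r) : Prop :=
  ¬σ.coin v 0 ∧ Live G σ i v a ∧ ∀ b ∈ (slots G r v u).erase a, ¬Arrived G σ i v b

variable (G σ) in
/-- At time `i` neither `v` nor any of its neighbours is explored. -/
def White (i : ℕ) (v : V) : Prop :=
  ¬σ.coin v 0 ∧ ∀ b ∈ slots G r v v, ¬Arrived G σ i v b

variable (G σ) in
/-- There is a path `v = v₀, v₁, …, vₘ` with `v₁ ≠ u` such that, at time `N`, no vertex `vₗ` with
`l < m` is explored and neither are its neighbours off the path. -/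
def Deep (N : ℕ) : ℕ → V → V → Prop
  | 0, _, _ => True
  | m + 1, v, u => ∃ w ∈ (G.neighborFinset v).erase u, ¬σ.coin v 0 ∧ Deep N m w v ∧
      ∀ b ∈ (slots G r v u).erase (Sum.inl w), ¬Arrived G σ N v b

variable (G σ) in
/-- The vertex `v` is explored at time `i`. -/
def Selected : ℕ → V → Prop
  | 0, v => σ.coin v 0
  | i + 1, v => ∃ a ∈ slots G r v v, σ.coin v (i + 1) ∧ Blue G σ i v v a

variable (G σ) in
/-- The vertex `v` is explored at time `i`, and no neighbour has a coin coming up at this time. -/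
def Kept (i : ℕ) (v : V) : Prop :=
  Selected G σ i v ∧ ∀ w ∈ G.neighborFinset v, ¬σ.coin w i

variable (G σ) in
/-- The vertices chosen for the forest. -/
def chosen (N k : ℕ) : Set V :=
  {v | (∃ i ∈ Finset.range (N + 1), Kept G σ i v) ∨ (White G σ N v ∧ ¬Deep G σ N k v v)}

lemma explored_succ : Explored G σ (i + 1) v u ↔
    Explored G σ i v u ∨ (σ.coin v (i + 1) ∧ ∃! a, a ∈ slots G r v u ∧ Arrived G σ i v a) :=
  Iff.rfl

lemma Explored.mono (h : Explored G σ i v u) (hij : i ≤ j) : Explored G σ j v u := by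
  induction hij with
  | refl => exact h
  | step _ ih => exact Or.inl ih

lemma Arrived.mono (h : Arrived G σ i v a) (hij : i ≤ j) : Arrived G σ j v a := by
  rcases a with w | s
  · exact Explored.mono h hij
  · exact le_trans (show σ.delay v s ≤ i from h) hij

lemma Live.arrived (h : Live G σ i v a) : Arrived G σ i v a := by
  induction i with
  | zero => exact h
  | succ i ih => exact h.elim (fun h => (ih h.1).mono i.le_succ) And.left

lemma existsUnique_arrived_iff (ha : a ∈ slots G r v u)
    (h : ∀ b ∈ (slots G r v u).erase a, ¬Arrived G σ i v b) :
    (∃! b, b ∈ slots G r v u ∧ Arrived G σ i v b) ↔ Arrived G σ i v a := by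
  have hb (b) (hb : b ∈ slots G r v u ∧ Arrived G σ i v b) : b = a := by
    by_contra hba
    exact h b (Finset.mem_erase.2 ⟨hba, hb.1⟩) hb.2
  exact ⟨fun ⟨b, hbs, _⟩ => hb b hbs ▸ hbs.2, fun hab => ⟨a, ⟨ha, hab⟩, hb⟩⟩

lemma not_explored_iff (ha : a ∈ slots G r v u)
    (h : ∀ b ∈ (slots G r v u).erase a, ¬Arrived G σ i v b) :
    ¬Explored G σ i v u ↔ ¬σ.coin v 0 ∧ (Live G σ i v a ∨ ¬Arrived G σ i v a) := by
  induction i with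
  | zero => simp [Explored, Live, em]
  | succ i ih =>
    have h' : ∀ b ∈ (slots G r v u).erase a, ¬Arrived G σ i v b :=
      fun b hb hi => h b hb (hi.mono i.le_succ)
    rw [explored_succ, existsUnique_arrived_iff ha h', not_or, ih h', Live]
    by_cases hi : Arrived G σ i v a
    · simp only [hi, hi.mono i.le_succ, not_true, and_false, or_false, and_true, and_assoc]
    · simp only [hi, mt Live.arrived hi, not_false_eq_true, and_false, or_true, and_true, false_or,
        false_and, em]

lemma exists_blue_iff : (∃ a ∈ slots G r v u, Blue G σ i v u a) ↔
    ¬Explored G σ i v u ∧ ∃! a, a ∈ slots G r v u ∧ Arrived G σ i v a := by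
  constructor
  · rintro ⟨a, ha, hcoin, hlive, hb⟩
    exact ⟨(not_explored_iff ha hb).2 ⟨hcoin, Or.inl hlive⟩,
      (existsUnique_arrived_iff ha hb).2 hlive.arrived⟩
  · rintro ⟨hexp, a, ⟨ha, harr⟩, huniq⟩
    have hb : ∀ b ∈ (slots G r v u).erase a, ¬Arrived G σ i v b := fun b hb h =>
      (Finset.mem_erase.1 hb).1 (huniq b ⟨(Finset.mem_erase.1 hb).2, h⟩)
    obtain ⟨hcoin, hlive⟩ := (not_explored_iff ha hb).1 hexp
    exact ⟨a, ha, hcoin, hlive.resolve_right (not_not.2 harr), hb⟩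

lemma Blue.unique (ha : Blue G σ i v u a) (hb : Blue G σ i v u b) (hbs : b ∈ slots G r v u) :
    a = b := by
  by_contra hne
  exact ha.2.2 b (Finset.mem_erase.2 ⟨Ne.symm hne, hbs⟩) hb.2.1.arrived

lemma ind_not_explored_succ : ind (¬Explored G σ (i + 1) v u) = ind (¬Explored G σ i v u) -
    ∑ a ∈ slots G r v u, ind (σ.coin v (i + 1) ∧ Blue G σ i v u a) := by
  rw [← ind_exists fun a _ b hb ha hb' => ha.2.unique hb'.2 hb]
  simp only [and_left_comm (b := σ.coin v (i + 1)), exists_and_left, exists_blue_iff, explored_succ]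
  by_cases hexp : Explored G σ i v u <;>
    by_cases hnew : σ.coin v (i + 1) ∧ ∃! a, a ∈ slots G r v u ∧ Arrived G σ i v a <;>
    simp [ind, hexp, hnew]

lemma explored_iff_of_not_explored (hvw : G.Adj v w) (hv : ¬Explored G σ i v v) :
    Explored G σ i w v ↔ Explored G σ i w w := by
  induction i generalizing v w with
  | zero => exact Iff.rfl
  | succ i ih =>
    have hv' : ¬Explored G σ i v v := fun h => hv (Or.inl h)
    by_cases hw : Explored G σ i w w
    · exact iff_of_true (Or.inl ((ih hvw hv').2 hw)) (Or.inl hw)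
    have hnarr : ¬Arrived G σ i w (Sum.inl v) := fun h => hv' ((ih hvw.symm hw).1 h)
    have hslots (a) : a ∈ slots G r w v ∧ Arrived G σ i w a ↔
        a ∈ slots G r w w ∧ Arrived G σ i w a := by
      refine ⟨fun h => ⟨slots_subset _ _ h.1, h.2⟩, fun h => ⟨?_, h.2⟩⟩
      rcases a with x | s
      · exact inl_mem_slots.2 ⟨fun hx => hnarr (hx ▸ h.2), (inl_mem_slots.1 h.1).2⟩
      · simpa [slots] using h.1
    simp only [explored_succ, ih hvw hv', hslots]

lemma White.not_explored (h : White G σ i v) : ¬Explored G σ i v v := by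
  induction i with
  | zero => exact h.1
  | succ i ih =>
    have h' : White G σ i v := ⟨h.1, fun b hb hi => h.2 b hb (hi.mono i.le_succ)⟩
    rw [explored_succ]
    rintro (hexp | ⟨-, a, ⟨ha, harr⟩, -⟩)
    · exact ih h' hexp
    · exact h'.2 a ha harr

lemma Selected.coin (h : Selected G σ i v) : σ.coin v i := by
  cases i with
  | zero => exact h
  | succ i => obtain ⟨a, -, hcoin, -⟩ := h; exact hcoin

lemma Selected.explored (h : Selected G σ i v) : Explored G σ i v v := by
  cases i with
  | zero => exact h
  | succ i =>
    obtain ⟨a, ha, hcoin, hblue⟩ := h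
    exact Or.inr ⟨hcoin, (exists_blue_iff.1 ⟨a, ha, hblue⟩).2⟩

lemma Selected.not_explored_existsUnique (h : Selected G σ (i + 1) v) :
    ¬Explored G σ i v v ∧ ∃! a, a ∈ slots G r v v ∧ Arrived G σ i v a := by
  obtain ⟨a, ha, -, hblue⟩ := h
  exact exists_blue_iff.1 ⟨a, ha, hblue⟩

lemma Selected.unique (hi : Selected G σ i v) (hj : Selected G σ j v) : i = j := by
  wlog hij : i ≤ j generalizing i j
  · exact (this hj hi (by omega)).symm
  by_contra hne
  obtain ⟨j, rfl⟩ := Nat.exists_eq_succ_of_ne_zero (by omega : j ≠ 0)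
  exact hj.not_explored_existsUnique.1 (hi.explored.mono (by omega))

lemma Kept.ne_of_adj (hi : Kept G σ i v) (hj : Kept G σ j w) (hvw : G.Adj v w) : i ≠ j := by
  rintro rfl
  exact hi.2 w (by simpa using hvw) hj.1.coin

lemma Kept.eq_of_lt (hv : Kept G σ k v) (hu : Kept G σ i u) (hw : Kept G σ j w) (hik : i < k)
    (hjk : j < k) (hvu : G.Adj v u) (hvw : G.Adj v w) : u = w := by
  obtain ⟨k, rfl⟩ := Nat.exists_eq_succ_of_ne_zero (by omega : k ≠ 0)
  obtain ⟨hv, huniq⟩ := hv.1.not_explored_existsUnique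
  have harr {x l} (hx : Kept G σ l x) (hl : l < k + 1) (hvx : G.Adj v x) :
      Sum.inl x ∈ slots G r v v ∧ Arrived G σ k v (Sum.inl x) :=
    ⟨inl_mem_slots.2 ⟨hvx.ne', hvx⟩,
      (explored_iff_of_not_explored hvx hv).2 (hx.1.explored.mono (by omega))⟩
  exact Sum.inl.inj (huniq.unique (harr hu hik hvu) (harr hw hjk hvw))

lemma explored_of_exists_kept (h : ∃ i ∈ Finset.range (N + 1), Kept G σ i v) :
    Explored G σ N v v := by
  obtain ⟨i, hi, hkept⟩ := h
  exact hkept.1.explored.mono (Finset.mem_range_succ_iff.1 hi)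

lemma white_and_not_deep (hv : v ∈ chosen G σ N k) (hexp : ¬Explored G σ N v v) :
    White G σ N v ∧ ¬Deep G σ N k v v :=
  hv.resolve_left fun h => hexp (explored_of_exists_kept h)

lemma White.deep_of_isTwoCore (hT : T ⊆ chosen G σ N k) (hcore : IsTwoCore G T) (hv : v ∈ T)
    (hwhite : White G σ N v) (j : ℕ) (u : V) : Deep G σ N j v u := by
  induction j generalizing u v with
  | zero => trivial
  | succ j ih =>
    obtain ⟨w, hwT, hwu, hvw⟩ : ∃ w ∈ T, w ≠ u ∧ G.Adj v w := by
      obtain ⟨a, ha, b, hb, hab, hva, hvb⟩ := hcore v hv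
      by_cases hau : a = u
      · exact ⟨b, hb, fun hbu => hab (hau.trans hbu.symm), hvb⟩
      · exact ⟨a, ha, hau, hva⟩
    have hw : ¬Explored G σ N w w := by
      rw [← explored_iff_of_not_explored hvw hwhite.not_explored]
      exact hwhite.2 (Sum.inl w) (inl_mem_slots.2 ⟨hvw.ne', hvw⟩)
    exact ⟨w, by simp [hwu, hvw], hwhite.1, ih hwT (white_and_not_deep (hT hwT) hw).1 v,
      fun b hb => hwhite.2 b (slots_subset _ _ (Finset.mem_of_mem_erase hb))⟩

lemma not_isTwoCore_of_forall_kept (hfin : T.Finite) (hne : T.Nonempty)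
    (hkept : ∀ v ∈ T, ∃ i, Kept G σ i v) : ¬IsTwoCore G T := fun hcore => by
  choose! t ht using hkept
  obtain ⟨v, hv, hmax⟩ := exists_max_image T t hfin hne
  have hlt (x) (hx : x ∈ T) (hvx : G.Adj v x) : t x < t v :=
    (hmax x hx).lt_of_ne' ((ht v hv).ne_of_adj (ht x hx) hvx)
  obtain ⟨a, ha, b, hb, hab, hva, hvb⟩ := hcore v hv
  exact hab ((ht v hv).eq_of_lt (ht a ha) (ht b hb) (hlt a ha hva) (hlt b hb hvb) hva hvb)

lemma isAcyclic_chosen : (G.induce (chosen G σ N k)).IsAcyclic := by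
  refine isAcyclic_induce_of_forall_not_isTwoCore fun T hT hfin hne hcore => ?_
  by_cases h : ∃ v ∈ T, White G σ N v
  · obtain ⟨v, hv, hwhite⟩ := h
    exact (white_and_not_deep (hT hv) hwhite.not_explored).2
      (hwhite.deep_of_isTwoCore hT hcore hv k v)
  · push Not at h
    exact not_isTwoCore_of_forall_kept hfin hne (fun v hv =>
      ((hT hv).resolve_right fun hw => h v hv hw.1).imp fun i hi => hi.2) hcore

lemma le_ind_mem_chosen : ∑ i ∈ Finset.range (N + 1), ind (Kept G σ i v) +
    (ind (White G σ N v) - ind (Deep G σ N k v v)) ≤ ind (v ∈ chosen G σ N k) := by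
  rw [← ind_exists fun i _ j _ hi hj => hi.1.unique hj.1, chosen, mem_ofPred_eq,
    ind_or fun h hw => hw.1.not_explored (explored_of_exists_kept h)]
  by_cases hwhite : White G σ N v <;> by_cases hdeep : Deep G σ N k v v <;>
    simp [ind, hwhite, hdeep]

end Exploration

/-- The coordinates of the sample space: the coins of times `0, …, N` and the delays of the missing
neighbours of every vertex. -/
abbrev Coord (V : Type*) (r N : ℕ) := V × (Fin (N + 1) ⊕ Fin r)

/-- The sample space of `N` rounds of the exploration process. A coin comes up if its coordinate is
`0`; the delay `N + 1` means that a missing neighbour is not explored by time `N`. -/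
abbrev Sample (V : Type*) (r N : ℕ) := Coord V r N → Fin (N + 2)

/-- The seed given by a point of the sample space. -/
def seed {V : Type*} {r N : ℕ} (ω : Sample V r N) : Seed V r where
  coin v i := ∃ h : i < N + 1, ω (v, Sum.inl ⟨i, h⟩) = 0
  delay v s := ω (v, Sum.inr s)

/-- The probability that a coin of time `i` comes up. -/
def coinProb (p ε : ℝ) (i : ℕ) : ℝ := if i = 0 then p else ε

/-- The probability that a missing neighbour is not explored before time `j`. Missing neighbours
thus have the law of actual ones up to time `N`. -/
def delayTail (r : ℕ) (p ε : ℝ) (N : ℕ) : ℕ → ℝ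
  | 0 => 1
  | j + 1 => if j ≤ N then surv r p ε j else 0

/-- The weights on the coordinates which define the law of the seed. -/
def weight {V : Type*} (r : ℕ) (p ε : ℝ) (N : ℕ) (k : Coord V r N) (a : Fin (N + 2)) : ℝ :=
  Sum.elim
    (fun i : Fin (N + 1) =>
      if a = 0 then coinProb p ε i else if a = 1 then 1 - coinProb p ε i else 0)
    (fun _ => delayTail r p ε N a - delayTail r p ε N (a + 1)) k.2

section Weight

variable {V : Type*} {r N i n : ℕ} {p ε : ℝ} {v : V} {M : Finset V}

lemma coinProb_mem_Icc (hr : 2 ≤ r) (hp₀ : 0 < p) (hp₁ : p < 1) (hε : IsStepSize r ε) (i : ℕ) :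
    coinProb p ε i ∈ Icc 0 1 := by
  unfold coinProb
  split_ifs
  · exact ⟨hp₀.le, hp₁.le⟩
  · exact ⟨hε.pos.le, (hε.lt_one hr).le⟩

lemma delayTail_antitone (hr : 3 ≤ r) (hp₀ : 0 < p) (hp₁ : p < 1) (hε : IsStepSize r ε) :
    Antitone (delayTail r p ε N) := by
  refine antitone_nat_of_succ_le fun j => ?_
  cases j with
  | zero => simp [delayTail, hp₀.le]
  | succ j =>
    simp only [delayTail]
    split_ifs
    · exact surv_antitone hr hp₀ hp₁ hε j.le_succ
    · omega
    · exact (surv_act_bounds hr hp₀ hp₁ hε j).1.le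
    · exact le_rfl

lemma weight_nonneg (hr : 3 ≤ r) (hp₀ : 0 < p) (hp₁ : p < 1) (hε : IsStepSize r ε)
    (k : Coord V r N) (a : Fin (N + 2)) : 0 ≤ weight r p ε N k a := by
  rcases k with ⟨v, i | _⟩
  · have hcoin := coinProb_mem_Icc (by omega) hp₀ hp₁ hε i
    simp only [weight, Sum.elim_inl]
    split_ifs
    · exact hcoin.1
    · exact sub_nonneg.2 hcoin.2
    · exact le_rfl
  · exact sub_nonneg.2 (delayTail_antitone hr hp₀ hp₁ hε (Nat.le_succ a))

lemma sum_weight_coin_mul (v : V) (i : Fin (N + 1)) (g : Fin (N + 2) → ℝ) :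
    ∑ a, weight r p ε N (v, Sum.inl i) a * g a =
      coinProb p ε i * g 0 + (1 - coinProb p ε i) * g 1 := by
  have h01 : (0 : Fin (N + 2)) ≠ 1 := by simp
  rw [← Finset.sum_subset (Finset.subset_univ {0, 1}), Finset.sum_pair h01]
  · simp [weight]
  · intro a _ ha
    simp only [Finset.mem_insert, Finset.mem_singleton, not_or] at ha
    simp [weight, ha.1, ha.2]

lemma sum_weight_delay_mul (v : V) (s : Fin r) (g : ℕ → ℝ) :
    ∑ a, weight r p ε N (v, Sum.inr s) a * g a =
      ∑ j ∈ Finset.range (N + 2), (delayTail r p ε N j - delayTail r p ε N (j + 1)) * g j := by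
  rw [Finset.sum_range]
  simp [weight]

lemma sum_weight (k : Coord V r N) : ∑ a, weight r p ε N k a = 1 := by
  rcases k with ⟨v, i | s⟩
  · simpa using sum_weight_coin_mul (r := r) (p := p) (ε := ε) v i fun _ => 1
  · have h := sum_weight_delay_mul (p := p) (ε := ε) (N := N) v s fun _ => 1
    simp only [mul_one, Finset.sum_range_sub'] at h
    simpa [delayTail] using h

lemma sum_range_sub_mul_ind_not_le (f : ℕ → ℝ) (hin : i + 1 ≤ n) :
    ∑ j ∈ Finset.range n, (f j - f (j + 1)) * ind (¬j ≤ i) = f (i + 1) - f n := by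
  induction n, hin using Nat.le_induction with
  | base =>
    rw [sub_self]
    refine Finset.sum_eq_zero fun j hj => ?_
    rw [ind_of_false (not_not.2 (Finset.mem_range_succ_iff.1 hj)), mul_zero]
  | succ n hn ih =>
    rw [Finset.sum_range_succ, ih, ind_of_true (by omega)]
    ring

lemma dependsOn_coin {S : Set (Coord V r N)} (hS : ∀ h : i < N + 1, (v, Sum.inl ⟨i, h⟩) ∈ S) :
    DependsOn (fun ω : Sample V r N => (seed ω).coin v i) S := fun _ _ hxy =>
  propext (exists_congr fun h => by rw [hxy _ (hS h)])

variable [Fintype V] [DecidableEq V]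

lemma prob_not_delay_le (hi : i ≤ N) (v : V) (s : Fin r) :
    prob (weight r p ε N) (fun ω : Sample V r N => ¬(seed ω).delay v s ≤ i) = surv r p ε i := by
  have h := expect_coord (m := weight r p ε N) (sum_weight (V := V)) (v, Sum.inr s)
    fun a => ind (¬(a : ℕ) ≤ i)
  rw [sum_weight_delay_mul v s fun j => ind (¬j ≤ i),
    sum_range_sub_mul_ind_not_le _ (by omega)] at h
  refine h.trans ?_
  simp [delayTail, hi]

lemma prob_coin (hi : i ≤ N) (v : V) :
    prob (weight r p ε N) (fun ω : Sample V r N => (seed ω).coin v i) = coinProb p ε i := by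
  have hlt : i < N + 1 := by omega
  have h := expect_coord (m := weight r p ε N) (sum_weight (V := V)) (v, Sum.inl ⟨i, hlt⟩)
    fun a => ind (a = 0)
  have hcoin (ω : Sample V r N) : (seed ω).coin v i ↔ ω (v, Sum.inl ⟨i, hlt⟩) = 0 :=
    ⟨fun ⟨_, h⟩ => h, fun h => ⟨hlt, h⟩⟩
  rw [sum_weight_coin_mul, ind_of_true rfl, ind_of_false (by simp), mul_one, mul_zero,
    add_zero] at h
  simpa only [prob, hcoin] using h

lemma prob_coin_and_forall_not_coin (hi : i ≤ N) (hM : v ∉ M) :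
    prob (weight r p ε N)
        (fun ω : Sample V r N => (seed ω).coin v i ∧ ∀ w ∈ M, ¬(seed ω).coin w i) =
      coinProb p ε i * (1 - coinProb p ε i) ^ M.card := by
  let S (w : V) : Set (Coord V r N) := {(w, Sum.inl ⟨i, by omega⟩)}
  have hdep (w) : DependsOn (fun ω : Sample V r N => (seed ω).coin w i) (S w) :=
    dependsOn_coin fun _ => rfl
  have hdisj {w w' : V} (h : w ≠ w') : Disjoint (S w) (S w') :=
    disjoint_singleton.2 fun heq => h (congrArg Prod.fst heq)
  rw [prob_and sum_weight (hdep v) (T := ⋃ w ∈ M, S w), prob_coin hi,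
    prob_forall sum_weight M (fun w _ => dependsOn_not (hdep w)) fun w _ w' _ h => hdisj h]
  · simp only [prob_not sum_weight, prob_coin hi, Finset.prod_const]
  · exact dependsOn_forall fun w hw =>
      dependsOn_not ((hdep w).mono (subset_biUnion_of_mem (u := S) hw))
  · exact disjoint_iUnion₂_right.2 fun w hw => hdisj (ne_of_mem_of_not_mem hw hM).symm

end Weight

section Region

variable {V : Type*} {G : SimpleGraph V} {r N i j k t t' m : ℕ} {u v w : V} {a b : V ⊕ Fin r}

/-- All coordinates except the coins of times after `t`. -/
def past (V : Type*) (r N t : ℕ) : Set (Coord V r N) :=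
  {k | ∀ l : Fin (N + 1), k.2 = Sum.inl l → (l : ℕ) ≤ t}

/-- The coins of time `t`. -/
def layer (V : Type*) (r N t : ℕ) : Set (Coord V r N) :=
  {k | ∃ l : Fin (N + 1), k.2 = Sum.inl l ∧ (l : ℕ) = t}

/-- The coins of `v` of times `1, …, t`. -/
def ownCoins (r N t : ℕ) (v : V) : Set (Coord V r N) :=
  {k | ∃ l : Fin (N + 1), k = (v, Sum.inl l) ∧ 1 ≤ (l : ℕ) ∧ (l : ℕ) ≤ t}

variable (G) in
/-- The coordinates in `past V r N t` of the vertices in the branch of depth `j` at `v` seen from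
`u`. -/
def region (r N j t : ℕ) (v u : V) : Set (Coord V r N) :=
  {k | k.1 ∈ branchBall G j v u ∧ k ∈ past V r N t}

variable (G) in
/-- The coordinates belonging to the branch of `v` at its neighbour `a`; for a missing neighbour,
this is its delay. -/
def branch (N j t : ℕ) (v : V) (a : V ⊕ Fin r) : Set (Coord V r N) :=
  Sum.elim (fun w => region G r N j t w v) (fun s => {(v, Sum.inr s)}) a

lemma coin_mem_past (hit : i ≤ t) (h : i < N + 1) :
    ((v, Sum.inl ⟨i, h⟩) : Coord V r N) ∈ past V r N t := fun l hl => by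
  obtain rfl := Sum.inl.inj hl
  exact hit

lemma delay_mem_past (s : Fin r) : ((v, Sum.inr s) : Coord V r N) ∈ past V r N t :=
  fun l hl => by cases hl

lemma past_mono (ht : t ≤ t') : past V r N t ⊆ past V r N t' :=
  fun _ hk l hl => (hk l hl).trans ht

lemma ownCoins_mono (ht : t ≤ t') : ownCoins r N t v ⊆ ownCoins r N t' v :=
  fun _ ⟨l, hl, h₁, hlt⟩ => ⟨l, hl, h₁, hlt.trans ht⟩

lemma region_mono (hij : i ≤ j) (ht : t ≤ t') : region G r N i t v u ⊆ region G r N j t' v u :=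
  fun _ hk => ⟨branchBall_mono hij _ _ hk.1, past_mono ht hk.2⟩

lemma branch_mono (hij : i ≤ j) (ht : t ≤ t') : branch G N i t v a ⊆ branch G N j t' v a := by
  rcases a with w | s
  · exact region_mono hij ht
  · exact le_rfl

lemma branch_subset_past : branch G N j t v a ⊆ past V r N t := by
  rcases a with w | s
  · exact fun k hk => hk.2
  · exact singleton_subset_iff.2 (delay_mem_past s)

lemma ownCoins_subset_past : ownCoins r N t v ⊆ past V r N t := by
  rintro _ ⟨l, rfl, -, hl⟩
  exact coin_mem_past hl l.2

lemma disjoint_layer_past : Disjoint (layer V r N (t + 1)) (past V r N t) :=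
  disjoint_left.2 fun k ⟨l, hl, ht⟩ hk => by
    have := hk l hl
    omega

lemma coin_mem_region (hit : i ≤ t) (h : i < N + 1) :
    ((v, Sum.inl ⟨i, h⟩) : Coord V r N) ∈ region G r N j t v u :=
  ⟨self_mem_branchBall _ _ _, coin_mem_past hit h⟩

lemma dependsOn_delay (s : Fin r) :
    DependsOn (fun ω : Sample V r N => (seed ω).delay v s ≤ i) {(v, Sum.inr s)} :=
  fun x y hxy => by simp only [seed, hxy _ rfl]

variable [Fintype V] [DecidableEq V] [DecidableRel G.Adj]

lemma branch_subset_region (ha : a ∈ slots G r v u) :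
    branch G N j t v a ⊆ region G r N (j + 1) t v u := by
  rcases a with w | s
  · rw [inl_mem_slots] at ha
    exact fun k hk => ⟨branchBall_subset_succ ha.2 ha.1 hk.1, hk.2⟩
  · exact singleton_subset_iff.2 ⟨self_mem_branchBall _ _ _, delay_mem_past s⟩

lemma coin_notMem_branch (hT : TreeLike G j) (ha : a ∈ slots G r v v) (l : Fin (N + 1)) :
    ((v, Sum.inl l) : Coord V r N) ∉ branch G N j t v a := by
  rcases a with w | s
  · exact fun h => hT.notMem v w (inl_mem_slots.1 ha).2 h.1
  · simp [branch]

lemma disjoint_branch (hT : TreeLike G j) (ha : a ∈ slots G r v v) (hb : b ∈ slots G r v v)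
    (hab : a ≠ b) : Disjoint (branch G N j t v a) (branch G N j t v b) := by
  rcases a with w | s <;> rcases b with w' | s'
  · exact disjoint_left.2 fun k hk hk' => disjoint_left.1 (hT.disjoint v w w' (inl_mem_slots.1 ha).2
      (inl_mem_slots.1 hb).2 fun h => hab (congrArg _ h)) hk.1 hk'.1
  · exact disjoint_singleton_right.2 fun hk => hT.notMem v w (inl_mem_slots.1 ha).2 hk.1
  · exact disjoint_singleton_left.2 fun hk => hT.notMem v w' (inl_mem_slots.1 hb).2 hk.1
  · exact disjoint_singleton.2 fun h => hab (congrArg Sum.inr (Sum.inr.inj (congrArg Prod.snd h)))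

lemma dependsOn_explored (i : ℕ) (v u : V) :
    DependsOn (fun ω : Sample V r N => Explored G (seed ω) i v u) (region G r N i i v u) := by
  induction i generalizing v u with
  | zero => exact dependsOn_coin fun h => coin_mem_region le_rfl h
  | succ i ih =>
    refine dependsOn_or ((ih v u).mono (region_mono i.le_succ i.le_succ)) (dependsOn_and
      (dependsOn_coin fun h => coin_mem_region le_rfl h) (dependsOn_existsUnique fun a ha => ?_))
    refine DependsOn.mono ((branch_subset_region ha).trans (region_mono le_rfl i.le_succ)) ?_
    rcases a with w | s
    · exact ih w v
    · exact dependsOn_delay s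

lemma dependsOn_arrived (i : ℕ) (v : V) (a : V ⊕ Fin r) :
    DependsOn (fun ω : Sample V r N => Arrived G (seed ω) i v a) (branch G N i i v a) := by
  rcases a with w | s
  · exact dependsOn_explored i w v
  · exact dependsOn_delay s

lemma dependsOn_live (i : ℕ) (v : V) (a : V ⊕ Fin r) :
    DependsOn (fun ω : Sample V r N => Live G (seed ω) i v a)
      (branch G N i i v a ∪ ownCoins r N i v) := by
  induction i with
  | zero => exact (dependsOn_arrived 0 v a).mono subset_union_left
  | succ i ih =>
    have hmono := branch_mono (G := G) (N := N) (v := v) (a := a) i.le_succ i.le_succ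
    refine dependsOn_or (dependsOn_and ?_ (dependsOn_not ?_))
      (dependsOn_and ?_ (dependsOn_not ?_))
    · exact ih.mono (union_subset_union hmono (ownCoins_mono i.le_succ))
    · exact dependsOn_coin fun h => Or.inr ⟨_, rfl, by simp, le_rfl⟩
    · exact (dependsOn_arrived (i + 1) v a).mono subset_union_left
    · exact (dependsOn_arrived i v a).mono (hmono.trans subset_union_left)

lemma dependsOn_blue (i : ℕ) (v u : V) (a : V ⊕ Fin r) :
    DependsOn (fun ω : Sample V r N => Blue G (seed ω) i v u a) (past V r N i) := by
  refine dependsOn_and (dependsOn_not (dependsOn_coin fun h => coin_mem_past i.zero_le h))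
    (dependsOn_and ?_ (dependsOn_forall fun b _ => dependsOn_not ?_))
  · exact (dependsOn_live i v a).mono (union_subset branch_subset_past ownCoins_subset_past)
  · exact (dependsOn_arrived i v b).mono branch_subset_past

lemma dependsOn_deep (m : ℕ) (v u : V) :
    DependsOn (fun ω : Sample V r N => Deep G (seed ω) N m v u) (region G r N (N + m) N v u) := by
  induction m generalizing v u with
  | zero => exact (dependsOn_const True).mono (empty_subset _)
  | succ m ih =>
    refine dependsOn_exists fun w hw => dependsOn_and
      (dependsOn_not (dependsOn_coin fun h => coin_mem_region N.zero_le h))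
      (dependsOn_and ?_ (dependsOn_forall fun b hb => dependsOn_not ?_))
    · exact (ih w v).mono (branch_subset_region (a := Sum.inl w)
        (inl_mem_slots.2 (by simpa using hw)))
    · exact (dependsOn_arrived N v b).mono
        ((branch_subset_region (Finset.mem_of_mem_erase hb)).trans (region_mono (by omega) le_rfl))

end Region

section Law

variable {V : Type*} [Fintype V] [DecidableEq V] {G : SimpleGraph V} [DecidableRel G.Adj]
  {r N i k m : ℕ} {p ε B : ℝ} {u v w : V} {a b : V ⊕ Fin r} {M : Finset V}

variable (G r N p ε) in
/-- The probability that `v` is not explored by time `i` if its neighbour `u` is ignored is the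
surviving fraction of the discretised system. -/
def SurvLaw (i : ℕ) : Prop :=
  ∀ v u, G.Adj v u →
    prob (weight r p ε N) (fun ω : Sample V r N => ¬Explored G (seed ω) i v u) = surv r p ε i

lemma SurvLaw.prob_not_arrived (h : SurvLaw G r N p ε i) (hi : i ≤ N) (ha : a ∈ slots G r v v) :
    prob (weight r p ε N) (fun ω : Sample V r N => ¬Arrived G (seed ω) i v a) = surv r p ε i := by
  rcases a with w | s
  · exact h w v (inl_mem_slots.1 ha).2.symm
  · exact prob_not_delay_le hi v s

lemma prob_live (hi : i ≤ N) (h : ∀ j ≤ i, SurvLaw G r N p ε j) (ha : a ∈ slots G r v v) :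
    prob (weight r p ε N) (fun ω : Sample V r N => Live G (seed ω) i v a) = act r p ε i := by
  induction i with
  | zero =>
    have h₀ := (h 0 le_rfl).prob_not_arrived N.zero_le ha
    rw [prob_not sum_weight, surv_zero] at h₀
    rw [act_zero]
    exact sub_right_injective h₀
  | succ i ih =>
    have hcoin : DependsOn (fun ω : Sample V r N => ¬(seed ω).coin v (i + 1))
        (layer V r N (i + 1)) := dependsOn_not (dependsOn_coin fun _ => ⟨_, rfl, rfl⟩)
    have hlive : DependsOn (fun ω : Sample V r N => Live G (seed ω) i v a) (past V r N i) :=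
      (dependsOn_live i v a).mono (union_subset branch_subset_past ownCoins_subset_past)
    simp only [Live]
    rw [prob_or fun ω h h' => h'.2 h.1.arrived,
      prob_and sum_weight hlive hcoin disjoint_layer_past.symm, prob_not sum_weight, prob_coin hi,
      prob_and_not (P := fun ω : Sample V r N => Arrived G (seed ω) (i + 1) v a)
        fun ω h => h.mono i.le_succ,
      ih (by omega) fun j hj => h j (by omega), (h i (by omega)).prob_not_arrived (by omega) ha,
      (h (i + 1) le_rfl).prob_not_arrived hi ha, act_succ, coinProb, if_neg i.succ_ne_zero]
    ring

lemma prob_and_forall_not_arrived (hi : i ≤ N) (hT : TreeLike G i) (h : SurvLaw G r N p ε i)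
    (ha : a ∈ slots G r v u) {Q : Sample V r N → Prop} {S : Set (Coord V r N)}
    (hQ : DependsOn Q S) (hS₀ : (v, Sum.inl 0) ∉ S)
    (hS : ∀ b ∈ (slots G r v u).erase a, Disjoint S (branch G N i i v b)) :
    prob (weight r p ε N) (fun ω : Sample V r N => ¬(seed ω).coin v 0 ∧ Q ω ∧
        ∀ b ∈ (slots G r v u).erase a, ¬Arrived G (seed ω) i v b) =
      (1 - p) * (prob (weight r p ε N) Q * surv r p ε i ^ ((slots G r v u).card - 1)) := by
  have hmem (b) (hb : b ∈ (slots G r v u).erase a) : b ∈ slots G r v v :=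
    slots_subset _ _ (Finset.mem_of_mem_erase hb)
  set U : Set (Coord V r N) := ⋃ b ∈ (slots G r v u).erase a, branch G N i i v b
  have hcoin : DependsOn (fun ω : Sample V r N => ¬(seed ω).coin v 0) {(v, Sum.inl 0)} :=
    dependsOn_not (dependsOn_coin fun _ => rfl)
  have harr (b) : DependsOn (fun ω : Sample V r N => ¬Arrived G (seed ω) i v b)
      (branch G N i i v b) := dependsOn_not (dependsOn_arrived i v b)
  have hall : DependsOn (fun ω : Sample V r N => ∀ b ∈ (slots G r v u).erase a,
      ¬Arrived G (seed ω) i v b) U :=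
    dependsOn_forall fun b hb => (harr b).mono (subset_biUnion_of_mem (u := branch G N i i v) hb)
  have hdisj : Disjoint {(v, Sum.inl 0)} (S ∪ U) := by
    refine disjoint_union_right.2 ⟨disjoint_singleton_left.2 hS₀,
      disjoint_iUnion₂_right.2 fun b hb => disjoint_singleton_left.2 ?_⟩
    exact coin_notMem_branch hT (hmem b hb) 0
  rw [prob_and sum_weight hcoin
      (dependsOn_and (hQ.mono subset_union_left) (hall.mono subset_union_right)) hdisj,
    prob_and sum_weight hQ hall (disjoint_iUnion₂_right.2 hS),
    prob_forall sum_weight _ (fun b _ => harr b) fun b hb b' hb' hne =>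
      disjoint_branch hT (hmem b hb) (hmem b' hb') hne,
    Finset.prod_congr rfl fun b hb => h.prob_not_arrived hi (hmem b hb), Finset.prod_const,
    Finset.card_erase_of_mem ha, prob_not sum_weight, prob_coin N.zero_le, coinProb, if_pos rfl]

lemma prob_blue (hi : i ≤ N) (hT : TreeLike G i) (h : ∀ j ≤ i, SurvLaw G r N p ε j)
    (ha : a ∈ slots G r v u) :
    prob (weight r p ε N) (fun ω : Sample V r N => Blue G (seed ω) i v u a) =
      (1 - p) * (act r p ε i * surv r p ε i ^ ((slots G r v u).card - 1)) := by
  have ha' := slots_subset _ _ ha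
  simp only [Blue]
  rw [prob_and_forall_not_arrived hi hT (h i le_rfl) ha (dependsOn_live i v a) ?_ ?_,
    prob_live hi h ha']
  · rintro (hk | ⟨l, hl, hl₁, -⟩)
    · exact coin_notMem_branch hT ha' _ hk
    · obtain rfl := Sum.inl.inj (congrArg Prod.snd hl)
      simp at hl₁
  · intro b hb
    obtain ⟨hba, hb⟩ := Finset.mem_erase.1 hb
    have hb' := slots_subset _ _ hb
    refine disjoint_union_left.2 ⟨disjoint_branch hT ha' hb' hba.symm, disjoint_left.2 ?_⟩
    rintro _ ⟨l, rfl, -, -⟩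
    exact coin_notMem_branch hT hb' l

lemma prob_coin_blue (hi : i + 1 ≤ N) (hT : TreeLike G i) (h : ∀ j ≤ i, SurvLaw G r N p ε j)
    (ha : a ∈ slots G r v u) (hM : v ∉ M) :
    prob (weight r p ε N) (fun ω : Sample V r N => ((seed ω).coin v (i + 1) ∧
        ∀ w ∈ M, ¬(seed ω).coin w (i + 1)) ∧ Blue G (seed ω) i v u a) =
      ε * (1 - ε) ^ M.card *
        ((1 - p) * (act r p ε i * surv r p ε i ^ ((slots G r v u).card - 1))) := by
  have hcoin (w) : DependsOn (fun ω : Sample V r N => (seed ω).coin w (i + 1))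
      (layer V r N (i + 1)) := dependsOn_coin fun _ => ⟨_, rfl, rfl⟩
  rw [prob_and sum_weight
      (dependsOn_and (hcoin v) (dependsOn_forall fun w _ => dependsOn_not (hcoin w)))
      (dependsOn_blue i v u a) disjoint_layer_past,
    prob_coin_and_forall_not_coin hi hM, prob_blue (by omega) hT h ha, coinProb,
    if_neg i.succ_ne_zero]

lemma survLaw_succ (hr : 2 ≤ r) (hd : ∀ v, G.degree v ≤ r) (hT : TreeLike G i) (hi : i + 1 ≤ N)
    (h : ∀ j ≤ i, SurvLaw G r N p ε j) : SurvLaw G r N p ε (i + 1) := by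
  intro v u hvu
  have hblue (a) (ha : a ∈ slots G r v u) :
      prob (weight r p ε N)
        (fun ω : Sample V r N => (seed ω).coin v (i + 1) ∧ Blue G (seed ω) i v u a) =
      ε * ((1 - p) * (act r p ε i * surv r p ε i ^ (r - 2))) := by
    have := prob_coin_blue hi hT h ha (Finset.notMem_empty v)
    rw [card_slots_of_adj (hd v) hvu, Nat.sub_sub] at this
    simpa using this
  have hprev := h i le_rfl v u hvu
  simp only [prob, ind_not_explored_succ, expect_sub, expect_sum] at hprev hblue ⊢
  rw [hprev, Finset.sum_congr rfl hblue, Finset.sum_const, card_slots_of_adj (hd v) hvu,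
    surv_succ, rate, nsmul_eq_mul, Nat.cast_sub (by omega)]
  push_cast
  ring

lemma survLaw (hr : 2 ≤ r) (hd : ∀ v, G.degree v ≤ r) (hT : TreeLike G N) (hi : i ≤ N) :
    SurvLaw G r N p ε i := by
  induction i using Nat.strong_induction_on with
  | _ i ih =>
    cases i with
    | zero =>
      intro v u _
      exact (prob_not sum_weight _).trans (congrArg (1 - ·) (prob_coin N.zero_le v))
    | succ i =>
      exact survLaw_succ hr hd (hT.mono (by omega)) hi fun j hj => ih j (by omega) (by omega)

lemma prob_deep_succ_le (hr : 3 ≤ r) (hp₀ : 0 < p) (hp₁ : p < 1) (hε : IsStepSize r ε)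
    (hd : ∀ v, G.degree v ≤ r) (hT : TreeLike G (N + m))
    (hB : ∀ w, G.Adj v w →
      prob (weight r p ε N) (fun ω : Sample V r N => Deep G (seed ω) N m w v) ≤ B) :
    prob (weight r p ε N) (fun ω : Sample V r N => Deep G (seed ω) N (m + 1) v u) ≤
      ((G.neighborFinset v).erase u).card *
        ((1 - p) * (B * surv r p ε N ^ ((slots G r v u).card - 1))) := by
  have hTN : TreeLike G N := hT.mono (by omega)
  refine (prob_exists_le (weight_nonneg hr hp₀ hp₁ hε) _ _).trans ?_
  rw [← nsmul_eq_mul]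
  refine Finset.sum_le_card_nsmul _ _ _ fun w hw => ?_
  have hw : Sum.inl w ∈ slots G r v u := inl_mem_slots.2 (by simpa using hw)
  have hw' := slots_subset _ _ hw
  rw [prob_and_forall_not_arrived le_rfl hTN (survLaw (by omega) hd hTN le_rfl) hw
    (dependsOn_deep m w v) (coin_notMem_branch (t := N) hT hw' 0) fun b hb =>
      (disjoint_branch (t := N) hT hw' (slots_subset _ _ (Finset.mem_of_mem_erase hb))
        (Finset.ne_of_mem_erase hb).symm).mono_right (branch_mono (by omega) le_rfl)]
  have := sub_nonneg.2 hp₁.le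
  have hsurv := (surv_act_bounds hr hp₀ hp₁ hε N).1
  have := hB w (inl_mem_slots.1 hw).2
  gcongr

lemma prob_deep_le_of_adj (hr : 3 ≤ r) (hp₀ : 0 < p) (hp₁ : p < 1) (hε : IsStepSize r ε)
    (hd : ∀ v, G.degree v ≤ r) (hT : TreeLike G (N + m)) (hvu : G.Adj v u) :
    prob (weight r p ε N) (fun ω : Sample V r N => Deep G (seed ω) N m v u) ≤
      rate r p (surv r p ε N) ^ m := by
  induction m generalizing v u with
  | zero => simp [prob, Deep, ind, expect_const sum_weight]
  | succ m ih =>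
    have hT' : TreeLike G (N + m) := hT.mono (by omega)
    refine (prob_deep_succ_le hr hp₀ hp₁ hε hd hT' fun w hw => ih hT' hw.symm).trans ?_
    have hsurv := (surv_act_bounds hr hp₀ hp₁ hε N).1
    have hrate := rate_pos (r := r) (by omega) hp₁ hsurv
    have := sub_nonneg.2 hp₁.le
    have hcard : (((G.neighborFinset v).erase u).card : ℝ) ≤ (r : ℝ) - 1 := by
      rw [Finset.cast_card_erase_of_mem (by simpa using hvu), G.card_neighborFinset_eq_degree]
      exact sub_le_sub_right (Nat.cast_le.2 (hd v)) 1
    rw [card_slots_of_adj (hd v) hvu, Nat.sub_sub]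
    calc _ ≤ ((r : ℝ) - 1) * ((1 - p) *
          (rate r p (surv r p ε N) ^ m * surv r p ε N ^ (r - 2))) := by gcongr
      _ = rate r p (surv r p ε N) ^ m * ((1 - p) * ((r : ℝ) - 1) * surv r p ε N ^ (r - 2)) := by
        ring
      _ = rate r p (surv r p ε N) ^ (m + 1) := by rw [pow_succ, ← rate]

lemma prob_deep_self_le (hr : 3 ≤ r) (hp₀ : 0 < p) (hp₁ : p < 1) (hε : IsStepSize r ε)
    (hd : ∀ v, G.degree v ≤ r) (hT : TreeLike G (N + m)) (v : V) :
    prob (weight r p ε N) (fun ω : Sample V r N => Deep G (seed ω) N (m + 1) v v) ≤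
      r * rate r p (surv r p ε N) ^ m := by
  refine (prob_deep_succ_le hr hp₀ hp₁ hε hd hT fun w hw =>
    prob_deep_le_of_adj hr hp₀ hp₁ hε hd hT hw.symm).trans ?_
  obtain ⟨hsurv, hact, hsum⟩ := surv_act_bounds hr hp₀ hp₁ hε N
  have hrate := rate_pos (r := r) (by omega) hp₁ hsurv
  have hcard : ((G.neighborFinset v).erase v).card ≤ r := by
    rw [Finset.erase_eq_of_notMem (by simp), G.card_neighborFinset_eq_degree]
    exact hd v
  have := sub_nonneg.2 hp₁.le
  have hpow : surv r p ε N ^ ((slots G r v v).card - 1) ≤ 1 :=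
    pow_le_one₀ hsurv.le (by linarith)
  calc _ ≤ (r : ℝ) * (1 * (rate r p (surv r p ε N) ^ m * 1)) := by
        gcongr
        linarith
    _ = r * rate r p (surv r p ε N) ^ m := by ring

lemma prob_white (hr : 2 ≤ r) (hd : ∀ v, G.degree v ≤ r) (hT : TreeLike G N) (v : V) :
    prob (weight r p ε N) (fun ω : Sample V r N => White G (seed ω) N v) =
      (1 - p) * surv r p ε N ^ r := by
  have hcard := card_slots_self (hd v)
  obtain ⟨a, ha⟩ : (slots G r v v).Nonempty := Finset.card_pos.1 (by omega)
  have hlaw := survLaw (p := p) (ε := ε) hr hd hT le_rfl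
  have hwhite (ω : Sample V r N) : White G (seed ω) N v ↔ ¬(seed ω).coin v 0 ∧
      ¬Arrived G (seed ω) N v a ∧ ∀ b ∈ (slots G r v v).erase a, ¬Arrived G (seed ω) N v b := by
    rw [White, ← Finset.forall_mem_insert a _ fun b => ¬Arrived G (seed ω) N v b,
      Finset.insert_erase ha]
  simp only [hwhite]
  rw [prob_and_forall_not_arrived le_rfl hT hlaw ha (dependsOn_not (dependsOn_arrived N v a))
    (coin_notMem_branch hT ha 0) fun b hb => disjoint_branch hT ha (Finset.mem_of_mem_erase hb)
      (Finset.ne_of_mem_erase hb).symm, hlaw.prob_not_arrived le_rfl ha, ← pow_succ', hcard,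
    Nat.sub_add_cancel (by omega)]

lemma le_prob_kept_zero (hp₀ : 0 ≤ p) (hp₁ : p ≤ 1) (hd : ∀ v, G.degree v ≤ r) (v : V) :
    p * (1 - p) ^ r ≤ prob (weight r p ε N) (fun ω : Sample V r N => Kept G (seed ω) 0 v) := by
  simp only [Kept, Selected]
  rw [prob_coin_and_forall_not_coin N.zero_le (by simp), G.card_neighborFinset_eq_degree, coinProb,
    if_pos rfl]
  exact mul_le_mul_of_nonneg_left
    (pow_le_pow_of_le_one (by linarith) (by linarith) (hd v)) hp₀

lemma le_prob_kept_succ (hr : 3 ≤ r) (hp₀ : 0 < p) (hp₁ : p < 1) (hε : IsStepSize r ε)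
    (hd : ∀ v, G.degree v ≤ r) (hT : TreeLike G N) (hi : i + 1 ≤ N) (v : V) :
    (1 - ε) ^ r * (ε * ((1 - p) * r * act r p ε i * surv r p ε i ^ (r - 1))) ≤
      prob (weight r p ε N) (fun ω : Sample V r N => Kept G (seed ω) (i + 1) v) := by
  have hkept (ω : Sample V r N) : Kept G (seed ω) (i + 1) v ↔ ∃ a ∈ slots G r v v,
      ((seed ω).coin v (i + 1) ∧ ∀ w ∈ G.neighborFinset v, ¬(seed ω).coin w (i + 1)) ∧
        Blue G (seed ω) i v v a := by
    simp only [Kept, Selected]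
    exact ⟨fun ⟨⟨a, ha, hv, hblue⟩, hw⟩ => ⟨a, ha, ⟨hv, hw⟩, hblue⟩,
      fun ⟨a, ha, ⟨hv, hw⟩, hblue⟩ => ⟨⟨a, ha, hv, hblue⟩, hw⟩⟩
  simp only [hkept]
  rw [prob_exists fun ω a _ b hb hblue hblue' => hblue.2.unique hblue'.2 hb,
    Finset.sum_congr rfl fun a ha => prob_coin_blue hi (hT.mono (by omega))
      (fun j hj => survLaw (by omega) hd hT (by omega)) ha (by simp),
    Finset.sum_const, card_slots_self (hd v), nsmul_eq_mul, G.card_neighborFinset_eq_degree]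
  have hε₀ := hε.pos
  have hε₁ := hε.lt_one (r := r) (by omega)
  obtain ⟨hsurv, hact, -⟩ := surv_act_bounds hr hp₀ hp₁ hε i
  have := sub_nonneg.2 hp₁.le
  calc _ ≤ (1 - ε) ^ G.degree v *
        (ε * ((1 - p) * r * act r p ε i * surv r p ε i ^ (r - 1))) :=
        mul_le_mul_of_nonneg_right (pow_le_pow_of_le_one (by linarith) (by linarith) (hd v))
          (by positivity)
    _ = _ := by ring

lemma density_le_prob_mem_chosen (hr : 3 ≤ r) (hp₀ : 0 < p) (hp₁ : p < 1) (hε : IsStepSize r ε)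
    (hd : ∀ v, G.degree v ≤ r) (hT : TreeLike G (N + k)) (v : V) :
    density r p ε N k ≤
      prob (weight r p ε N) fun ω : Sample V r N => v ∈ chosen G (seed ω) N (k + 1) := by
  have hTN : TreeLike G N := hT.mono (by omega)
  have hchosen := expect_mono (weight_nonneg (N := N) hr hp₀ hp₁ hε) fun ω =>
    le_ind_mem_chosen (G := G) (σ := seed ω) (N := N) (k := k + 1) (v := v)
  rw [expect_add, expect_sub, expect_sum, Finset.sum_range_succ'] at hchosen
  have hkept : (1 - ε) ^ r * ∑ i ∈ Finset.range N,
      ε * ((1 - p) * r * act r p ε i * surv r p ε i ^ (r - 1)) ≤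
      ∑ i ∈ Finset.range N,
        prob (weight r p ε N) fun ω : Sample V r N => Kept G (seed ω) (i + 1) v := by
    rw [Finset.mul_sum]
    exact Finset.sum_le_sum fun i hi =>
      le_prob_kept_succ hr hp₀ hp₁ hε hd hTN (Finset.mem_range.1 hi) v
  have hkept₀ := le_prob_kept_zero (N := N) (ε := ε) hp₀.le hp₁.le hd v
  have hdeep := prob_deep_self_le hr hp₀ hp₁ hε hd hT v
  have hwhite := prob_white (p := p) (ε := ε) (by omega) hd hTN v
  unfold prob at hkept hkept₀ hdeep hwhite ⊢
  rw [density]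
  linarith

end Law

section LargeGirth

open SimpleGraph

variable {r : ℕ} {δ : ℝ}

lemma density_mul_card_le_tau {V : Type*} [Fintype V] {G : SimpleGraph V} [DecidableRel G.Adj]
    {N k : ℕ} {p ε : ℝ} (hr : 3 ≤ r) (hp₀ : 0 < p) (hp₁ : p < 1) (hε : IsStepSize r ε)
    (hd : ∀ v, G.degree v ≤ r) (hT : TreeLike G (N + k)) :
    density r p ε N k * Fintype.card V ≤ tau G := by
  classical
  obtain ⟨ω, hω⟩ := exists_expect_le (weight_nonneg hr hp₀ hp₁ hε) sum_weight
    fun ω : Sample V r N => ∑ v, ind (v ∈ chosen G (seed ω) N (k + 1))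
  let S : Finset V := {v | v ∈ chosen G (seed ω) N (k + 1)}
  have hacyclic : (G.induce (S : Set V)).IsAcyclic := by
    have hS : (S : Set V) = chosen G (seed ω) N (k + 1) := by ext; simp [S]
    exact hS ▸ isAcyclic_chosen
  calc density r p ε N k * Fintype.card V
    _ = ∑ _v : V, density r p ε N k := by simp [mul_comm]
    _ ≤ ∑ v, prob (weight r p ε N) fun ω : Sample V r N => v ∈ chosen G (seed ω) N (k + 1) :=
      Finset.sum_le_sum fun v _ => density_le_prob_mem_chosen hr hp₀ hp₁ hε hd hT v
    _ ≤ ∑ v, ind (v ∈ chosen G (seed ω) N (k + 1)) := (expect_sum _ _).symm.trans_le hω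
    _ = S.card := by simp [S, ind]
    _ ≤ tau G := Nat.cast_le.2 (card_le_tau hacyclic)

theorem exists_girth_xi_le_tau.{u} (hr : 3 ≤ r) (hδ : 0 < δ) :
    ∃ g : ℕ, 0 < g ∧ ∀ (V : Type u) [Fintype V] (G : SimpleGraph V) [DecidableRel G.Adj],
      G.maxDegree ≤ r → (g : ℕ∞) ≤ G.egirth →
        (xi r - δ) * (Fintype.card V : ℝ) ≤ (tau G : ℝ) := by
  obtain ⟨c, ⟨p, ⟨hp₀, hp₁⟩, hc⟩, hxi, -⟩ :=
    (isLUB_xi hr).exists_between (sub_lt_self (xi r) (half_pos hδ))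
  obtain ⟨φ, h⟩ := exists_isTerminalFraction hr hp₀ hp₁
  rw [h.eq_xiVal_of_isXi (by omega) hp₀ hc] at hxi
  obtain ⟨ε, hε, N, k, hdensity⟩ := h.exists_density_ge hr hp₀ (half_pos hδ)
  refine ⟨2 * (N + k) + 3, by omega, fun V _ G _ hdeg hg => ?_⟩
  have htau := density_mul_card_le_tau hr hp₀ hp₁ hε (fun v => (G.degree_le_maxDegree v).trans hdeg)
    (treeLike_of_le_egirth (j := N + k) hg (by omega))
  refine le_trans (mul_le_mul_of_nonneg_right ?_ (Nat.cast_nonneg _)) htau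
  linarith

end LargeGirth

end InducedForest

end

/-- The first two conjuncts say that `ξ(r)` is well defined; the third is the lower bound on the
largest induced forest; the fourth says that the tabulated numbers are, to four decimals, values
`ξ(r, p₀)` for a suitable `p₀` (hence lower bounds for `ξ(r)`). -/
theorem corollary1p1 (r : ℕ) (hr : 3 ≤ r) :
    (∀ p₀ ∈ Set.Ioo (0 : ℝ) 1, ∃! c : ℝ, InducedForest.IsXi r p₀ c) ∧
    IsLUB (InducedForest.xiValues r) (InducedForest.xi r) ∧
    (∀ δ : ℝ, 0 < δ → ∃ g : ℕ, 0 < g ∧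
      ∀ (V : Type*) [Fintype V] (G : SimpleGraph V) [DecidableRel G.Adj],
        G.maxDegree ≤ r → (g : ℕ∞) ≤ G.egirth →
          (InducedForest.xi r - δ) * (Fintype.card V : ℝ) ≤ (InducedForest.tau G : ℝ)) ∧
    (r ≤ 10 → ∃ p₀ ∈ Set.Ioo (0 : ℝ) 1, ∃ c : ℝ, InducedForest.IsXi r p₀ c ∧
      InducedForest.tableXi r ≤ c ∧ c < InducedForest.tableXi r + 0.0001) :=
  ⟨fun _ hp => InducedForest.existsUnique_isXi hr hp.1 hp.2, InducedForest.isLUB_xi hr,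
    fun _ hδ => InducedForest.exists_girth_xi_le_tau hr hδ, InducedForest.exists_isXi_table hr⟩
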